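/- Let $\widehat M_1$ be a Kähler torus $T^4$ with Kähler form $\omega$ and complex structure $J$, carrying a Lagrangian torus fibration $\pi:\widehat M_1\to T^2_B$ with a zero section and a Kähler $T^2$-structure. That is, $\widehat M_1= T^2_B\times T^2_F$ with $T^2_B=T^2_F=\mathbb R^2/\mathbb Z^2$ (smoothly), $\pi$ is the first projection, $\omega$ and $J$ are invariant under translations of the fibers, the fibers and the zero section are Lagrangian, and $J$ maps the tangent spaces of the zero section to the tangent spaces of the fibers. Assume that the Kähler metric is Calabi–Yau, i.e. that there is a holomorphic volume form of constant length. For $\varepsilon\in(0,1]$ let $\omega_\varepsilon=\varepsilon\,\omega$, and let $J_\varepsilon$ be equal to $\varepsilon^{-1}J$ on horizontal vectors (tangent to the $T^2_B$-factor) and to $\varepsilon J$ on vertical vectors (tangent to the $T^2_F$-factor). Let $E\to\widehat M_1$ be a smooth hermitian vector bundle of rank $2$, let $\varepsilon_\nu\in(0,1]$ with $\varepsilon_\nu\to0$, and let $\Xi_\nu$ be a smooth unitary connection on $E$ that is Hermitian–Yang–Mills with respect to $(\omega_{\varepsilon_\nu},J_{\varepsilon_\nu})$: its curvature is of type $(1,1)$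 for $J_{\varepsilon_\nu}$, and the contraction of the curvature with $\omega_{\varepsilon_\nu}$ is a constant imaginary multiple of the identity. In a unitary frame $s$ of $E$ over $\pi^{-1}(U)$, $U\subset T^2_B$ open, write the connection matrix of $\Xi_\nu$ as $\Xi_{\nu}'\cdot 1+\Xi_{\nu}^\circ$ according to $\mathfrak u(2)=i\mathbb R\oplus\mathfrak{su}(2)$, so that $\Xi_\nu'$ is half of its trace, and let $(\Xi'_\nu)_2$ be the fiberwise constant part of the one-form $\Xi'_\nu$: each of its four coefficients (two in base directions, two in fiber directions) with respect to linear coordinates of $T^2_B\times T^2_F$ is replaced by its average over the fibers of $\pi$. Then there is a finite open covering $\{U_i\}$ of $T^2_B$ such that for each $i$ there are a subsequence $(\Xi_{\nu_k})_k$, smooth unitary frames (gauges) $s_{k}$ of $E$ over $\pi^{-1}(U_i)$, and a smooth one-form $\alpha$ on $\pi^{-1}(U_i)$, such that the forms $(\Xi'_{\nu_k})_2$, computed in the frames $s_k$, converge to $\alpha$ in $C^\infty$ on $\pi^{-1}(U_i)$ with respect to the fixed metric of $\widehat M_1$, i.e. uniformly with all derivatives. -/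

import Mathlib

open Filter Topology Matrix MeasureTheory
open scoped ContDiff Matrix.Norms.L2Operator

noncomputable section

/-!
Notation and conventions. The total space is `T_B × T_F` with `T_B = ℝ²/ℤ²` the base torus and
`T_F = ℝ²/ℤ²` the fiber torus; `π` is the first projection. Tensors, bundles and connections on the
total space are described on its universal cover `ℝ² × ℝ²`, whose points are written `(b, x)`, by
objects that are periodic (or equivariant) under the deck group `ℤ² × ℤ²`.
-/

/-- The plane; its `sup` norm is only used to speak of smoothness and of uniform convergence. -/
abbrev Plane : Type := Fin 2 → ℝ

/-- The universal cover of the total space, points `(b, x)`, `b` over the base, `x` in the fiber. -/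
abbrev Cover : Type := Plane × Plane

/-- The deck group of the universal cover. -/
abbrev Deck : Type := (Fin 2 → ℤ) × (Fin 2 → ℤ)

/-- Complex `2 × 2` matrices. -/
abbrev Mat : Type := Matrix (Fin 2) (Fin 2) ℂ

/-- The translation vector of a deck transformation. -/
def Deck.shift (γ : Deck) : Cover := (fun i => (γ.1 i : ℝ), fun i => (γ.2 i : ℝ))

/-- The preimage, in the universal cover of the total space, of a subset of the base torus. -/
def overBase (U : Set (UnitAddTorus (Fin 2))) : Set Cover :=
  {p | (fun i => (p.1 i : UnitAddCircle)) ∈ U}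

/-- The wedge product of two alternating `2`-forms, on four vectors. -/
def wedgeTwo {𝕜 E : Type*} [Semiring 𝕜] [AddCommGroup E] [Module 𝕜 E]
    (α : Cover → Cover → 𝕜) (β : Cover → Cover → E) (v₀ v₁ v₂ v₃ : Cover) : E :=
  α v₀ v₁ • β v₂ v₃ - α v₀ v₂ • β v₁ v₃ + α v₀ v₃ • β v₁ v₂
    + α v₁ v₂ • β v₀ v₃ - α v₁ v₃ • β v₀ v₂ + α v₂ v₃ • β v₀ v₁

/-- A Kähler torus `T⁴` with a Lagrangian torus fibration over `T_B` with a zero section and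
a Kähler `T²`-structure: the Kähler structure `(ω, J)` is invariant under the fiberwise action of
`T²`, the fibers and the zero section `x = 0` are Lagrangian, and `J` maps the tangent spaces of
the zero section to the tangent spaces of the fibers. -/
structure KahlerT2Structure where
  /-- the Kähler form `ω` -/
  form : Cover → Cover [⋀^Fin 2]→L[ℝ] ℝ
  /-- the complex structure -/
  J : Cover → Cover →L[ℝ] Cover
  form_smooth : ContDiff ℝ ∞ form
  J_smooth : ContDiff ℝ ∞ J
  form_periodic : ∀ (γ : Deck) (p : Cover), form (p + γ.shift) = form p
  J_periodic : ∀ (γ : Deck) (p : Cover), J (p + γ.shift) = J p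
  form_closed : extDeriv form = 0
  J_sq : ∀ p u, J p (J p u) = -u
  /-- integrability of `J`: its Nijenhuis tensor vanishes (on coordinate vector fields) -/
  J_integrable : ∀ (u v p : Cover),
    VectorField.lieBracket ℝ (fun q => J q u) (fun q => J q v) p
      - J p (VectorField.lieBracket ℝ (fun q => J q u) (fun _ => v) p)
      - J p (VectorField.lieBracket ℝ (fun _ => u) (fun q => J q v) p) = 0
  form_J : ∀ p u v, form p ![J p u, J p v] = form p ![u, v]
  form_pos : ∀ p u, u ≠ 0 → 0 < form p ![u, J p u]
  form_invariant : ∀ b x t : Plane, form (b, x + t) = form (b, x)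
  J_invariant : ∀ b x t : Plane, J (b, x + t) = J (b, x)
  fiber_lagrangian : ∀ (b x w w' : Plane), form (b, x) ![(0, w), (0, w')] = 0
  zeroSection_lagrangian : ∀ b w w' : Plane, form (b, 0) ![(w, 0), (w', 0)] = 0
  J_zeroSection : ∀ b w : Plane, (J (b, 0) (w, 0)).1 = 0

namespace KahlerT2Structure

/-- The Kähler metric is Calabi-Yau: there is a holomorphic volume form (a closed form of type
`(2,0)`) of constant length, normalized by `Ω ∧ conj Ω = ω ∧ ω`. -/
def IsCalabiYau (K : KahlerT2Structure) : Prop :=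
  ∃ Ω : Cover → Cover [⋀^Fin 2]→L[ℝ] ℂ,
    ContDiff ℝ ∞ Ω ∧ (∀ (γ : Deck) (p : Cover), Ω (p + γ.shift) = Ω p) ∧ extDeriv Ω = 0 ∧
    (∀ p u v, Ω p ![K.J p u, v] = Complex.I * Ω p ![u, v]) ∧
    ∀ p v₀ v₁ v₂ v₃,
      wedgeTwo (fun u v => Ω p ![u, v]) (fun u v => starRingEnd ℂ (Ω p ![u, v])) v₀ v₁ v₂ v₃
        = ((wedgeTwo (fun u v => K.form p ![u, v]) (fun u v => K.form p ![u, v]) v₀ v₁ v₂ v₃ : ℝ) : ℂ)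

/-- The rescaled Kähler form `ω_ε = ε ω`. -/
def formScaled (K : KahlerT2Structure) (ε : ℝ) (p : Cover) : Cover [⋀^Fin 2]→L[ℝ] ℝ :=
  ε • K.form p

/-- The rescaled complex structure `J_ε`: it equals `ε⁻¹ J` on horizontal vectors (for the flat
structure of the fibration) and `ε J` on vertical vectors. -/
def JScaled (K : KahlerT2Structure) (ε : ℝ) (p : Cover) : Cover →L[ℝ] Cover :=
  ε⁻¹ • (K.J p ∘L .inl ℝ Plane Plane ∘L .fst ℝ Plane Plane)
    + ε • (K.J p ∘L .inr ℝ Plane Plane ∘L .snd ℝ Plane Plane)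

end KahlerT2Structure

/-- A smooth hermitian rank two vector bundle (a `U(2)`-bundle) on the total space, given by a factor
of automorphy: it is the quotient of `(ℝ² × ℝ²) × ℂ²` by `(p, c) ∼ (p + γ, e γ p c)`. As the
universal cover is contractible, every such bundle is of this form. -/
structure UTwoBundle where
  e : Deck → Cover → Mat
  e_smooth : ∀ γ, ContDiff ℝ ∞ (e γ)
  e_unitary : ∀ γ p, e γ p ∈ unitaryGroup (Fin 2) ℂ
  e_add : ∀ γ δ p, e (γ + δ) p = e γ (p + δ.shift) * e δ p

/-- A smooth unitary connection `d + A` on the bundle `E`: a skew-hermitian matrix-valued one-form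
on the universal cover with the equivariance that makes `d + A` descend to `E`. -/
structure UTwoConnection (E : UTwoBundle) where
  A : Cover → Cover →L[ℝ] Mat
  A_smooth : ContDiff ℝ ∞ A
  A_skew : ∀ p v, (A p v)ᴴ = -A p v
  A_equivariant : ∀ (γ : Deck) (p v : Cover),
    A (p + γ.shift) v * E.e γ p = E.e γ p * A p v - fderiv ℝ (E.e γ) p v

/-- The curvature `F = dA + A ∧ A`. -/
def UTwoConnection.curvature {E : UTwoBundle} (Ξ : UTwoConnection E) (p u v : Cover) : Mat :=
  fderiv ℝ Ξ.A p u v - fderiv ℝ Ξ.A p v u + (Ξ.A p u * Ξ.A p v - Ξ.A p v * Ξ.A p u)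

/-- `Ξ` is Hermitian-Yang-Mills for `(ω_ε, J_ε)`: the curvature `F` has type `(1,1)`, that is
`F^{0,2} = F^{2,0} = 0`, and its contraction with `ω_ε` is a constant multiple `i c` of the identity,
that is `F ∧ ω_ε = i c (ω_ε ∧ ω_ε) • 1`. (The value of `c` is then forced by the degree of the
bundle, upon taking the trace and integrating.) -/
def IsHermitianYangMills (K : KahlerT2Structure) (ε : ℝ) {E : UTwoBundle}
    (Ξ : UTwoConnection E) : Prop :=
  (∀ p u v, Ξ.curvature p (K.JScaled ε p u) (K.JScaled ε p v) = Ξ.curvature p u v) ∧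
  ∃ c : ℝ, ∀ p v₀ v₁ v₂ v₃,
    wedgeTwo (fun u v => K.formScaled ε p ![u, v]) (Ξ.curvature p) v₀ v₁ v₂ v₃
      = (Complex.I * c * (wedgeTwo (fun u v => K.formScaled ε p ![u, v])
          (fun u v => K.formScaled ε p ![u, v]) v₀ v₁ v₂ v₃ : ℝ)) • (1 : Mat)

/-- A smooth unitary frame of `E` over `π⁻¹(U)`, that is, a local gauge there, which is global in
the fiber direction. The columns of `s` are the lifts of the sections in the frame. -/
structure IsUnitaryFrame (E : UTwoBundle) (U : Set (UnitAddTorus (Fin 2))) (s : Cover → Mat) :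
    Prop where
  smooth : ContDiffOn ℝ ∞ s (overBase U)
  unitary : ∀ p ∈ overBase U, s p ∈ unitaryGroup (Fin 2) ℂ
  equivariant : ∀ (γ : Deck), ∀ p ∈ overBase U, s (p + γ.shift) = E.e γ p * s p

/-- The connection matrix `s⁻¹ A s + s⁻¹ ds` of `Ξ` in the frame `s`, where `s⁻¹ = sᴴ`. -/
def UTwoConnection.inFrame {E : UTwoBundle} (Ξ : UTwoConnection E) (s : Cover → Mat) (p : Cover) :
    Cover →L[ℝ] Mat :=
  ContinuousLinearMap.mulLeftRight ℝ Mat (s p)ᴴ (s p) ∘L Ξ.A p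
    + ContinuousLinearMap.mul ℝ Mat (s p)ᴴ ∘L fderiv ℝ s p

/-- The `iℝ`-component, in `u(2) = iℝ ⊕ su(2)`, of a matrix-valued covector: half of the trace (as
the coefficient of the identity matrix). -/
def centralPart (a : Cover →L[ℝ] Mat) : Cover →L[ℝ] ℂ :=
  (1 / 2 : ℝ) • ((Matrix.traceLinearMap (Fin 2) ℝ ℂ).toContinuousLinearMap ∘L a)

/-- The fiberwise constant part of a one-form on `π⁻¹(U)`: all four coefficients (with respect to
the coordinates `(b, x)`) are replaced by their averages over the fibers. -/
def fiberwiseConstantPart (a : Cover → Cover →L[ℝ] ℂ) (p : Cover) : Cover →L[ℝ] ℂ :=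
  ∫ t in Set.Icc (0 : Plane) 1, a (p.1, t)

/-- Convergence in `C^∞` on `π⁻¹(U)` of one-forms given by their periodic lifts: the coefficients
converge uniformly on `π⁻¹(U)` together with their partial derivatives of every order. The
coordinates are fixed and the total space is compact, so this is uniform convergence of all
covariant derivatives for any fixed smooth metric on the total space. -/
def ConvergesSmoothly (U : Set (UnitAddTorus (Fin 2))) (a : ℕ → Cover → Cover →L[ℝ] ℂ)
    (α : Cover → Cover →L[ℝ] ℂ) : Prop :=
  ∀ r : ℕ, TendstoUniformlyOn (fun k p => iteratedFDeriv ℝ r (a k) p)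
    (fun p => iteratedFDeriv ℝ r α p) atTop (overBase U)

end

/-!
The traces of the connections are controlled by two elliptic rigidity statements, and no compactness
theorem for connections enters. Write `i a_ν` for the trace of the connection form of `Ξ_ν` on the
universal cover. The differences `a_ν - a_0` are periodic one-forms, so they can be averaged over the
fibers; the average `traceDiff` is a one-form on the base torus with values in the covectors of the
total space. By invariance along the fibers, `J` maps a horizontal vector `w` over `b` to a vertical
vector `N(b) w`, and `ω` is given by a pairing `P(b)` between horizontal and vertical vectors.

*The base part is closed.* That the curvature is of type `(1,1)` for `J_ε` expresses the averaged
base-base component of the trace of the curvature as `ε⁻² det N` times its fiber-fiber component, and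
the latter is `-c` for a constant `c`, a multiple of the degree of `E` along the fibers, which does
not depend on the connection. As the integral over the base of the former does not depend on the
connection either, two different values of `ε` force `c = 0` (`degree_eq_zero`; this is where
`ε_ν → 0` is used). Hence the averaged curvature has no base-base component, and the base part of
`traceDiff` is closed (`fderiv_traceDiff_hor_symm`).

*The fiber coefficients are constant.* In the mixed component of the type condition and of the
contraction with `ω_ε` the parameter `ε` cancels. Let `M` be the matrix of the derivatives of the two
fiber coefficients of `traceDiff`. Then `M` is symmetric with respect to `N`, and its contraction
with `P` is a divergence that is a constant multiple of `det P`, so it vanishes. Positivity of the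
metric gives `det M ≤ 0` with equality only for `M = 0`. But `∫ det M = 0`, as `det M` is a
divergence, so `M = 0` (`traceDiff_ver_eq`).

*Gauges.* Since `c = 0`, the determinant of `E` is trivial along the fibers, and a generic section of
`E` over a neighbourhood of a fiber has no zeros, as the fiber has real dimension two and `E` has
real rank four. Hence `E` has a unitary frame `s` over the preimage of a small ball
(`exists_isUnitaryFrame`). In the frame `exp (-iψ) s` the averaged central part of `Ξ_ν` is
that of `Ξ_0` in the frame `s`, plus half of `i traceDiff`, minus `i dψ`. Taking for `ψ` half of a
potential of the base part plus a linear function with periods in `2πℤ` along the fibers leaves the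
form of `Ξ_0` plus `i (c₀ dx₀ + c₁ dx₁)` with constants `c_j ∈ [0, 2π]`
(`exists_frame_fiberwiseConstantPart_eq`). A subsequence of these constants converges.
-/

noncomputable section

/-! ### Integrals depending on parameters, and integrals of periodic functions -/

section ParametricIntegral

variable {X Y F : Type} [NormedAddCommGroup X] [NormedSpace ℝ X] [FiniteDimensional ℝ X]
  [NormedAddCommGroup Y] [NormedSpace ℝ Y] [MeasureSpace Y] [BorelSpace Y]
  [SecondCountableTopology Y] [IsFiniteMeasureOnCompacts (volume : Measure Y)]
  [NormedAddCommGroup F] [NormedSpace ℝ F]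

/-- Differentiation under the integral sign. -/
theorem hasFDerivAt_setIntegral_of_contDiffOn {V : Set X} (hV : IsOpen V) {K : Set Y}
    (hK : IsCompact K) {f : X × Y → F} (hf : ContDiffOn ℝ ∞ f (V ×ˢ Set.univ)) {b : X}
    (hb : b ∈ V) :
    HasFDerivAt (fun b => ∫ t in K, f (b, t))
      (∫ t in K, fderiv ℝ f (b, t) ∘L .inl ℝ X Y) b := by
  have hO : IsOpen (V ×ˢ (Set.univ : Set Y)) := hV.prod isOpen_univ
  have hd : ContinuousOn (fun q => fderiv ℝ f q ∘L ContinuousLinearMap.inl ℝ X Y)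
      (V ×ˢ (Set.univ : Set Y)) :=
    (hf.continuousOn_fderiv_of_isOpen hO (by simp)).clm_comp continuousOn_const
  obtain ⟨r, hr, hrV⟩ := Metric.nhds_basis_closedBall.mem_iff.1 (hV.mem_nhds hb)
  have hslice : ∀ x ∈ V, ContinuousOn (fun t => f (x, t)) K := fun x hx =>
    hf.continuousOn.comp (by fun_prop) fun t _ => ⟨hx, trivial⟩
  have hslice' : ContinuousOn
      (fun t => fderiv ℝ f (b, t) ∘L ContinuousLinearMap.inl ℝ X Y) K :=
    hd.comp (by fun_prop) fun t _ => ⟨hb, trivial⟩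
  obtain ⟨C, hC⟩ := ((isCompact_closedBall b r).prod hK).exists_bound_of_continuousOn
    (hd.mono (Set.prod_mono hrV (Set.subset_univ _)))
  refine hasFDerivAt_integral_of_dominated_of_fderiv_le (bound := fun _ => C)
    (F := fun x t => f (x, t))
    (F' := fun x t => fderiv ℝ f (x, t) ∘L ContinuousLinearMap.inl ℝ X Y)
    (Metric.closedBall_mem_nhds b hr) ?_ ?_ ?_ ?_ ?_ ?_
  · filter_upwards [hV.mem_nhds hb] with x hx
    exact (hslice x hx).aestronglyMeasurable hK.measurableSet
  · exact (hslice b hb).integrableOn_compact hK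
  · exact hslice'.aestronglyMeasurable hK.measurableSet
  · exact (ae_restrict_iff' hK.measurableSet).2 (ae_of_all _ fun t ht x hx => hC (x, t) ⟨hx, ht⟩)
  · exact (continuousOn_const (c := C)).integrableOn_compact hK
  · refine ae_of_all _ fun t x hx => ?_
    have h1 : HasFDerivAt f (fderiv ℝ f (x, t)) (x, t) :=
      ((hf.contDiffAt (hO.mem_nhds ⟨hrV hx, trivial⟩)).differentiableAt (by simp)).hasFDerivAt
    exact h1.comp x (hasFDerivAt_prodMk_left x t)

theorem contDiffOn_setIntegral {V : Set X} (hV : IsOpen V) {K : Set Y} (hK : IsCompact K)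
    {f : X × Y → F} (hf : ContDiffOn ℝ ∞ f (V ×ˢ Set.univ)) :
    ContDiffOn ℝ ∞ (fun b => ∫ t in K, f (b, t)) V := by
  rw [contDiffOn_infty]
  intro n
  induction n generalizing F with
  | zero =>
    exact contDiffOn_zero.2 fun b hb =>
      (hasFDerivAt_setIntegral_of_contDiffOn hV hK hf hb).continuousAt.continuousWithinAt
  | succ n ih =>
    have hO : IsOpen (V ×ˢ (Set.univ : Set Y)) := hV.prod isOpen_univ
    push_cast
    refine (contDiffOn_succ_iff_fderiv_of_isOpen hV).2 ⟨fun b hb =>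
      (hasFDerivAt_setIntegral_of_contDiffOn hV hK
        hf hb).differentiableAt.differentiableWithinAt, by simp, ?_⟩
    refine (ih (f := fun q => fderiv ℝ f q ∘L ContinuousLinearMap.inl ℝ X Y) ?_).congr
      fun b hb => (hasFDerivAt_setIntegral_of_contDiffOn hV hK hf hb).fderiv
    exact (hf.fderiv_of_isOpen hO (by simp)).clm_comp contDiffOn_const

theorem contDiff_setIntegral {K : Set Y} (hK : IsCompact K)
    {f : X × Y → F} (hf : ContDiff ℝ ∞ f) :
    ContDiff ℝ ∞ (fun b => ∫ t in K, f (b, t)) :=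
  contDiffOn_univ.1 (contDiffOn_setIntegral isOpen_univ hK hf.contDiffOn)

end ParametricIntegral

section Periodic

variable {F : Type} [NormedAddCommGroup F] [NormedSpace ℝ F]

/-- The derivative of a periodic function integrates to zero over the unit square. -/
theorem setIntegral_fderiv_eq_zero_of_periodic {g : Plane → F} (hg : ContDiff ℝ 1 g)
    (hper : ∀ (n : Fin 2 → ℤ) (x : Plane), g (x + fun i => (n i : ℝ)) = g x) (v : Plane) :
    ∫ x in Set.Icc (0 : Plane) 1, fderiv ℝ g x v = 0 := by
  have hc : Continuous fun x => fderiv ℝ g x := hg.continuous_fderiv (by simp)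
  have key : ∀ j : Fin 2, ∫ x in Set.Icc (0 : Plane) 1, fderiv ℝ g x (Pi.single j 1) = 0 := by
    intro j
    have h := integral_divergence_of_hasFDerivAt_off_countable' (E := F) (n := 1)
      (0 : Plane) 1 (by intro i; simp)
      (fun i => if i = j then g else 0) (fun i x => if i = j then fderiv ℝ g x else 0) ∅
      (by simp) (fun i => by
        split_ifs
        · exact hg.continuous.continuousOn
        · exact continuousOn_const)
      (fun x _ i => by
        split_ifs
        · exact (hg.differentiable (by simp) x).hasFDerivAt
        · exact hasFDerivAt_const (0 : F) x)
      (by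
        apply Continuous.integrableOn_Icc
        refine continuous_finsetSum _ fun i _ => ?_
        split_ifs
        · exact hc.clm_apply continuous_const
        · exact continuous_const)
    have h2 : ∀ x, (∑ i, (if i = j then fderiv ℝ g x else 0) (Pi.single i 1))
        = fderiv ℝ g x (Pi.single j 1) := fun x => by
      rw [Finset.sum_eq_single j] <;> simp +contextual
    simp only [h2] at h
    rw [h]
    refine Finset.sum_eq_zero fun i _ => ?_
    by_cases hij : i = j
    · subst hij
      simp only [if_true, sub_eq_zero]
      refine integral_congr_ae (ae_of_all _ fun y => ?_)
      simp only
      rw [← hper (Pi.single i 1) (Fin.insertNth i ((0 : Plane) i) y)]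
      congr 1
      ext k
      rcases eq_or_ne k i with rfl | hk
      · simp
      · obtain ⟨m, rfl⟩ := Fin.exists_succAbove_eq hk
        simp [hk]
    · simp [hij]
  have hv : v = ∑ j, v j • (Pi.single j 1 : Plane) := by
    ext k; simp [Finset.sum_apply, Pi.single_apply]
  have hfun : ∀ x, fderiv ℝ g x v = ∑ j, v j • fderiv ℝ g x (Pi.single j 1) := fun x => by
    conv_lhs => rw [hv]
    simp only [map_sum, map_smul]
  simp only [hfun]
  rw [integral_finsetSum]
  · simp only [integral_smul, key, smul_zero, Finset.sum_const_zero]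
  · intro j _
    exact ((hc.clm_apply continuous_const).const_smul (v j)).integrableOn_Icc

/-- A continuous nonnegative periodic function with vanishing integral over the unit square
vanishes identically. -/
theorem eq_zero_of_setIntegral_eq_zero_of_periodic {g : Plane → ℝ} (hg : Continuous g)
    (hper : ∀ (n : Fin 2 → ℤ) (x : Plane), g (x + fun i => (n i : ℝ)) = g x)
    (h0 : ∀ x, 0 ≤ g x) (hI : ∫ x in Set.Icc (0 : Plane) 1, g x = 0) (x : Plane) : g x = 0 := by
  have hae : g =ᵐ[volume.restrict (Set.Icc (0 : Plane) 1)] 0 :=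
    (integral_eq_zero_iff_of_nonneg (fun x => h0 x) hg.integrableOn_Icc).1 hI
  have hae2 : g =ᵐ[volume.restrict (interior (Set.Icc (0 : Plane) 1))] 0 :=
    ae_restrict_of_ae_restrict_of_subset interior_subset hae
  have h1 := Measure.eqOn_open_of_ae_eq hae2 isOpen_interior hg.continuousOn continuousOn_const
  have h2 : Set.EqOn g 0 (closure (interior (Set.Icc (0 : Plane) 1))) :=
    h1.closure hg continuous_const
  have h3 : closure (interior (Set.Icc (0 : Plane) 1)) = Set.Icc 0 1 := by
    rw [← Set.pi_univ_Icc, interior_pi_set Set.finite_univ, closure_pi_set]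
    simp
  rw [h3] at h2
  have hx := hper (fun i => -⌊x i⌋) x
  rw [← hx]
  refine h2 ⟨fun i => ?_, fun i => ?_⟩
  · simpa using Int.floor_le (x i)
  · have := Int.lt_floor_add_one (x i)
    simp only [Pi.add_apply, Int.cast_neg, Pi.one_apply]
    linarith

end Periodic

/-! ### Lifting circle-valued functions and normal forms of factors of automorphy -/

section Lifts

variable {X : Type} [NormedAddCommGroup X] [NormedSpace ℝ X]

/-- Lifting a path in the unit circle along `t ↦ exp (i t)` by integrating its logarithmic
derivative. -/
theorem exists_real_eq_exp_of_path {G : ℝ → ℂ} (hG : ContDiff ℝ 1 G) (hn : ∀ t, ‖G t‖ = 1) :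
    G 1 = Complex.exp (Complex.I *
      ((Complex.arg (G 0) + ∫ t in (0 : ℝ)..1, (starRingEnd ℂ (G t) * deriv G t).im : ℝ) : ℂ)) := by
  set h : ℝ → ℝ := fun t => (starRingEnd ℂ (G t) * deriv G t).im with hh
  have hGc := hG.continuous
  have hG'c := hG.continuous_deriv (by simp)
  have hc : Continuous h := by
    have : Continuous fun t => starRingEnd ℂ (G t) := Complex.continuous_conj.comp hGc
    exact Complex.continuous_im.comp (this.mul hG'c)
  set Θ : ℝ → ℝ := fun t => Complex.arg (G 0) + ∫ s in (0 : ℝ)..t, h s with hΘ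
  have hΘd : ∀ t, HasDerivAt Θ (h t) t := fun t =>
    (intervalIntegral.integral_hasDerivAt_right (hc.intervalIntegrable _ _)
      (hc.stronglyMeasurableAtFilter _ _) hc.continuousAt).const_add _
  have hGd : ∀ t, HasDerivAt G (deriv G t) t := fun t =>
    (hG.differentiable (by simp) t).hasDerivAt
  have hGG : ∀ t, starRingEnd ℂ (G t) * G t = 1 := fun t => by
    rw [mul_comm, Complex.mul_conj, Complex.normSq_eq_norm_sq, hn]; simp
  -- the logarithmic derivative of a unit complex function is purely imaginary
  have hre : ∀ t, starRingEnd ℂ (G t) * deriv G t = Complex.I * (h t : ℂ) := by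
    intro t
    have h1 : HasDerivAt (fun t => starRingEnd ℂ (G t) * G t)
        (starRingEnd ℂ (deriv G t) * G t + starRingEnd ℂ (G t) * deriv G t) t :=
      (Complex.conjCLE.hasFDerivAt.comp_hasDerivAt t (hGd t)).mul (hGd t)
    have h2 : HasDerivAt (fun t => starRingEnd ℂ (G t) * G t) 0 t := by
      simp only [hGG]; exact hasDerivAt_const t 1
    have h3 := h1.unique h2
    have h4 := congrArg Complex.re h3
    simp only [Complex.add_re, Complex.mul_re, Complex.conj_re, Complex.conj_im,
      Complex.zero_re] at h4
    apply Complex.ext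
    · simp only [Complex.mul_re, Complex.conj_re, Complex.conj_im, Complex.I_re, Complex.I_im,
        Complex.ofReal_re, Complex.ofReal_im]
      linarith
    · simp [hh]
  have hG' : ∀ t, deriv G t = Complex.I * (h t : ℂ) * G t := fun t => by
    rw [← hre, mul_right_comm, hGG, one_mul]
  have hE : ∀ t, HasDerivAt (fun t => G t * Complex.exp (-(Complex.I * (Θ t : ℂ)))) 0 t := by
    intro t
    have := (hGd t).mul (((hΘd t).ofReal_comp.const_mul Complex.I).neg.cexp)
    refine this.congr_deriv ?_
    rw [hG' t]; simp only [Pi.neg_apply]; ring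
  have hcst := is_const_of_deriv_eq_zero (fun t => (hE t).differentiableAt)
    (fun t => (hE t).deriv) 1 0
  have h0 : Complex.exp (Complex.I * (Θ 0 : ℂ)) = G 0 := by
    have := Complex.norm_mul_exp_arg_mul_I (G 0)
    rw [hn] at this
    simp only [hΘ, intervalIntegral.integral_same, add_zero]
    rw [mul_comm]; simpa using this
  have hone : ∀ z : ℂ, Complex.exp (-z) * Complex.exp z = 1 := fun z => by
    rw [← Complex.exp_add]; simp
  simp only [← h0] at hcst
  rw [mul_comm (Complex.exp _), hone] at hcst
  calc G 1 = G 1 * (Complex.exp (-(Complex.I * (Θ 1 : ℂ)))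
        * Complex.exp (Complex.I * (Θ 1 : ℂ))) := by
        rw [hone, mul_one]
    _ = _ := by rw [← mul_assoc, hcst, one_mul]

/-- A smooth unit complex function on a vector space has a smooth real logarithm. -/
theorem exists_contDiff_eq_exp [FiniteDimensional ℝ X] {g : X → ℂ} (hg : ContDiff ℝ ∞ g)
    (hn : ∀ p, ‖g p‖ = 1) :
    ∃ θ : X → ℝ, ContDiff ℝ ∞ θ ∧ ∀ p, g p = Complex.exp (Complex.I * (θ p : ℂ)) := by
  refine ⟨fun p => Complex.arg (g 0) +
    ∫ t in Set.Icc (0 : ℝ) 1, (starRingEnd ℂ (g (t • p)) * fderiv ℝ g (t • p) p).im, ?_, ?_⟩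
  · refine contDiff_const.add (contDiff_setIntegral (f := fun q : X × ℝ =>
      (starRingEnd ℂ (g (q.2 • q.1)) * fderiv ℝ g (q.2 • q.1) q.1).im) isCompact_Icc ?_)
    have h1 : ContDiff ℝ ∞ fun q : X × ℝ => q.2 • q.1 := contDiff_snd.smul contDiff_fst
    have h2 : ContDiff ℝ ∞ fun q : X × ℝ => fderiv ℝ g (q.2 • q.1) q.1 :=
      ((hg.fderiv_right (m := ∞) (by simp)).comp h1).clm_apply contDiff_fst
    exact Complex.imCLM.contDiff.comp
      ((Complex.conjCLE.contDiff.comp (hg.comp h1)).mul h2)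
  · intro p
    have hline : ∀ t : ℝ, HasDerivAt (fun t : ℝ => g (t • p)) (fderiv ℝ g (t • p) p) t := by
      intro t
      have h1 : HasDerivAt (fun t : ℝ => t • p) p t := by
        simpa using (hasDerivAt_id t).smul_const p
      exact ((hg.differentiable (by simp) (t • p)).hasFDerivAt).comp_hasDerivAt t h1
    have h := exists_real_eq_exp_of_path (G := fun t : ℝ => g (t • p))
      ((hg.comp (contDiff_id.smul contDiff_const)).of_le (by simp)) (fun t => hn _)
    simp only [one_smul, zero_smul] at h
    rw [h, intervalIntegral.integral_of_le zero_le_one, ← integral_Icc_eq_integral_Ioc]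
    simp only [(hline _).deriv]

theorem contDiff_tsum_of_eventually_zero {f : ℕ → X → ℝ} (hf : ∀ k, ContDiff ℝ ∞ (f k))
    {u : X → ℝ} (hu : Continuous u) (h0 : ∀ (k : ℕ) p, u p ≤ k → f k p = 0) :
    ContDiff ℝ ∞ fun p => ∑' k, f k p := by
  rw [contDiff_iff_contDiffAt]
  intro p
  obtain ⟨N, hN⟩ := exists_nat_gt (u p)
  have hloc : (fun q => ∑' k, f k q) =ᶠ[𝓝 p] fun q => ∑ k ∈ Finset.range N, f k q := by
    filter_upwards [hu.continuousAt.eventually_lt_const hN] with q hq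
    refine tsum_eq_sum fun k hk => h0 k q ?_
    have : N ≤ k := by simpa using hk
    exact hq.le.trans (by exact_mod_cast this)
  exact ((ContDiff.sum fun k _ => hf k).contDiffAt).congr_of_eventuallyEq hloc

theorem summable_of_eventually_zero {f : ℕ → ℝ} {u : ℝ} (h0 : ∀ k : ℕ, u ≤ k → f k = 0) :
    Summable f := by
  obtain ⟨N, hN⟩ := exists_nat_gt u
  refine summable_of_ne_finset_zero (s := Finset.range N) fun k hk => h0 k ?_
  have : N ≤ k := by simpa using hk
  exact hN.le.trans (by exact_mod_cast this)

/-- The difference equation `φ (p + v) - φ p = θ p` has a smooth solution, which inherits the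
periods of `θ` transverse to `v`. -/
theorem exists_contDiff_sub_eq {θ : X → ℝ} (hθ : ContDiff ℝ ∞ θ) (ℓ : X →L[ℝ] ℝ) (v : X)
    (hv : ℓ v = 1) :
    ∃ φ : X → ℝ, ContDiff ℝ ∞ φ ∧ (∀ p, φ (p + v) - φ p = θ p) ∧
      ∀ w, ℓ w = 0 → (∀ p, θ (p + w) = θ p) → ∀ p, φ (p + w) = φ p := by
  -- `1 = χ + (1 - χ)` with `χ` cutting off at `ℓ = 0`: sum one part of `θ` over the backward
  -- translates, the other one over the forward translates; both sums are locally finite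
  set χ := Real.smoothTransition with hχ
  set f : ℕ → X → ℝ := fun k p => χ (ℓ p - k) * θ (p - ((k : ℝ) + 1) • v) with hf
  set g : ℕ → X → ℝ := fun k p => (1 - χ (ℓ p + k + 1)) * θ (p + (k : ℝ) • v) with hg
  have hf0 : ∀ (k : ℕ) p, ℓ p ≤ k → f k p = 0 := fun k p h => by
    simp only [hf, hχ]
    rw [Real.smoothTransition.zero_of_nonpos (by linarith), zero_mul]
  have hg0 : ∀ (k : ℕ) p, -ℓ p ≤ k → g k p = 0 := fun k p h => by
    simp only [hg, hχ]
    rw [Real.smoothTransition.one_of_one_le (by linarith), sub_self, zero_mul]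
  have hχs : ContDiff ℝ ∞ χ := Real.smoothTransition.contDiff
  have hfs : ∀ k, ContDiff ℝ ∞ (f k) := fun k =>
    (hχs.comp (ℓ.contDiff.sub contDiff_const)).mul (hθ.comp (contDiff_id.sub contDiff_const))
  have hgs : ∀ k, ContDiff ℝ ∞ (g k) := fun k =>
    (contDiff_const.sub (hχs.comp ((ℓ.contDiff.add contDiff_const).add contDiff_const))).mul
      (hθ.comp (contDiff_id.add contDiff_const))
  refine ⟨fun p => (∑' k, f k p) - ∑' k, g k p,
    (contDiff_tsum_of_eventually_zero hfs ℓ.continuous hf0).sub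
      (contDiff_tsum_of_eventually_zero hgs ℓ.continuous.neg hg0), fun p => ?_, ?_⟩
  · have e1 : ∑' k, f k (p + v) = χ (ℓ p + 1) * θ p + ∑' k, f k p := by
      rw [(summable_of_eventually_zero (fun k => hf0 k (p + v))).tsum_eq_zero_add]
      congr 1
      · simp [hf, hv]
      · refine tsum_congr fun k => ?_
        simp only [hf, map_add, hv]
        congr 2
        · push_cast; ring
        · push_cast; module
    have e2 : ∑' k, g k p = (1 - χ (ℓ p + 1)) * θ p + ∑' k, g k (p + v) := by
      rw [(summable_of_eventually_zero (fun k => hg0 k p)).tsum_eq_zero_add]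
      congr 1
      · simp [hg]
      · refine tsum_congr fun k => ?_
        simp only [hg, map_add, hv]
        congr 2
        · congr 2; push_cast; ring
        · push_cast; module
    simp only [e1, e2]; ring
  · intro w hw hθw p
    have h1 : ∀ q : X, θ (p + w + q) = θ (p + q) := fun q => by
      rw [add_right_comm, hθw]
    simp only [hf, hg, map_add, hw, add_zero, sub_eq_add_neg, h1]

/-- Normal form of a factor of automorphy with values in the unit circle for a rank two lattice:
up to a coboundary it is determined by its degree, a real number `c`. -/
theorem exists_automorphy_normalForm [FiniteDimensional ℝ X] {d₁ d₂ : X → ℂ}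
    (hd₁ : ContDiff ℝ ∞ d₁) (hd₂ : ContDiff ℝ ∞ d₂) (hn₁ : ∀ p, ‖d₁ p‖ = 1)
    (hn₂ : ∀ p, ‖d₂ p‖ = 1) (ℓ₁ ℓ₂ : X →L[ℝ] ℝ) (v₁ v₂ : X) (h₁₁ : ℓ₁ v₁ = 1) (h₂₁ : ℓ₂ v₁ = 0)
    (h₂₂ : ℓ₂ v₂ = 1) (hcomm : ∀ p, d₁ (p + v₂) * d₂ p = d₂ (p + v₁) * d₁ p) :
    ∃ (φ : X → ℝ) (c : ℝ), ContDiff ℝ ∞ φ ∧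
      (∀ p, d₁ p = Complex.exp (Complex.I * ((φ (p + v₁) - φ p : ℝ) : ℂ))) ∧
      ∀ p, d₂ p = Complex.exp (Complex.I * ((φ (p + v₂) - φ p - c * ℓ₁ p : ℝ) : ℂ)) := by
  obtain ⟨θ₁, hθ₁, hd₁'⟩ := exists_contDiff_eq_exp hd₁ hn₁
  obtain ⟨θ₂, hθ₂, hd₂'⟩ := exists_contDiff_eq_exp hd₂ hn₂
  obtain ⟨φ₁, hφ₁, hφ₁v, -⟩ := exists_contDiff_sub_eq hθ₁ ℓ₁ v₁ h₁₁
  set c : X → ℝ := fun p => θ₁ (p + v₂) + θ₂ p - (θ₂ (p + v₁) + θ₁ p) with hc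
  have htr : ∀ v : X, ContDiff ℝ ∞ fun p : X => p + v := fun v => contDiff_id.add contDiff_const
  have hcs : ContDiff ℝ ∞ c :=
    ((hθ₁.comp (htr v₂)).add hθ₂).sub ((hθ₂.comp (htr v₁)).add hθ₁)
  have hexp : ∀ p, Complex.exp (Complex.I * (c p : ℂ)) = 1 := fun p => by
    have h := hcomm p
    simp only [hd₁', hd₂'] at h
    rw [← Complex.exp_add, ← Complex.exp_add] at h
    simp only [hc]
    push_cast
    rw [mul_sub, Complex.exp_sub, mul_add, mul_add, h, div_self (Complex.exp_ne_zero _)]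
  have hcd : ∀ p, fderiv ℝ c p = 0 := fun p => by
    have h1 : HasFDerivAt (fun p => Complex.exp (Complex.I * (c p : ℂ))) _ p :=
      (((Complex.ofRealCLM.hasFDerivAt.comp p
        (hcs.differentiable (by simp) p).hasFDerivAt)).const_mul Complex.I).cexp
    have h2 : HasFDerivAt (fun p => Complex.exp (Complex.I * (c p : ℂ)))
        (0 : X →L[ℝ] ℂ) p := by
      simp only [hexp]; exact hasFDerivAt_const _ _
    have h3 := h1.unique h2
    ext v
    have h4 := DFunLike.congr_fun h3 v
    simpa using h4
  have hcc : ∀ p q, c p = c q :=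
    is_const_of_fderiv_eq_zero (hcs.differentiable (by simp)) hcd
  obtain ⟨φ₂, hφ₂, hφ₂v, hφ₂w⟩ := exists_contDiff_sub_eq
    (θ := fun p => θ₂ p - φ₁ (p + v₂) + φ₁ p + c 0 * ℓ₁ p)
    (((hθ₂.sub (hφ₁.comp (htr v₂))).add hφ₁).add (contDiff_const.mul ℓ₁.contDiff)) ℓ₂ v₂ h₂₂
  have hφ₂' : ∀ p, φ₂ (p + v₁) = φ₂ p := hφ₂w v₁ h₂₁ fun p => by
    have e1 := hcc p 0
    have e2 := hφ₁v p
    have e3 := hφ₁v (p + v₂)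
    rw [add_right_comm] at e3
    simp only [hc, map_add, h₁₁] at e1 ⊢
    linarith
  refine ⟨fun p => φ₁ p + φ₂ p, c 0, hφ₁.add hφ₂, fun p => ?_, fun p => ?_⟩
  · rw [hd₁', ← hφ₁v]; simp only [hφ₂']; congr 3; ring
  · rw [hd₂']; congr 3; linarith [hφ₂v p]

end Lifts

/-! ### Averages over the fibers -/

/-- The horizontal coordinate vectors on the universal cover. -/
def hor (i : Fin 2) : Cover := (Pi.single i 1, 0)

/-- The vertical coordinate vectors on the universal cover. -/
def ver (i : Fin 2) : Cover := (0, Pi.single i 1)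

/-- The exterior derivative `da` of a real one-form `a` on the universal cover, as a bilinear
form. -/
def curl (a : Cover → Cover →L[ℝ] ℝ) (p : Cover) : Cover →L[ℝ] Cover →L[ℝ] ℝ :=
  fderiv ℝ a p - (fderiv ℝ a p).flip

theorem curl_apply (a : Cover → Cover →L[ℝ] ℝ) (p u v : Cover) :
    curl a p u v = fderiv ℝ a p u v - fderiv ℝ a p v u := rfl

theorem continuous_curl {a : Cover → Cover →L[ℝ] ℝ} (ha : ContDiff ℝ ∞ a) :
    Continuous (curl a) := by
  have h : ContDiff ℝ ∞ (fderiv ℝ a) := ha.fderiv_right (by simp)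
  exact (h.sub ((ContinuousLinearMap.flipₗᵢ ℝ Cover Cover ℝ).contDiff.comp h)).continuous

/-- The average over the fiber above `b`. -/
def fiberAverage {F : Type} [NormedAddCommGroup F] [NormedSpace ℝ F] (f : Cover → F) (b : Plane) :
    F :=
  ∫ t in Set.Icc (0 : Plane) 1, f (b, t)

section FiberAverage

theorem periodic_of_generators {F : Type} {f : Plane → F}
    (h : ∀ (i : Fin 2) (x : Plane), f (x + Pi.single i 1) = f x) (n : Fin 2 → ℤ) (x : Plane) :
    f (x + fun i => (n i : ℝ)) = f x := by
  have h1 : ∀ (i : Fin 2) (m : ℤ) (x : Plane), f (x + (m : ℝ) • Pi.single i 1) = f x := by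
    intro i m
    induction m using Int.induction_on with
    | zero => simp
    | succ m ih =>
      intro x
      rw [← ih x, ← h i (x + ((m : ℤ) : ℝ) • Pi.single i 1)]; congr 1; push_cast; module
    | pred m ih =>
      intro x
      rw [← ih x, ← h i (x + ((-(m : ℤ) - 1 : ℤ) : ℝ) • Pi.single i 1)]
      congr 1; push_cast; module
  have hx : x + (fun i => (n i : ℝ))
      = x + (n 0 : ℝ) • Pi.single 0 1 + (n 1 : ℝ) • Pi.single 1 1 := by
    ext i; fin_cases i <;> simp
  rw [hx, h1, h1]

variable {F G : Type} [NormedAddCommGroup F]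

theorem integrableOn_fiber {f : Cover → F} (hf : Continuous f) (b : Plane) :
    IntegrableOn (fun t => f (b, t)) (Set.Icc (0 : Plane) 1) :=
  (hf.comp (by fun_prop)).integrableOn_Icc

variable [NormedSpace ℝ F]

theorem fiberAverage_congr {f g : Cover → F} {b : Plane} (h : ∀ t, f (b, t) = g (b, t)) :
    fiberAverage f b = fiberAverage g b := by
  simp only [fiberAverage, h]

theorem contDiff_fiberAverage {f : Cover → F} (hf : ContDiff ℝ ∞ f) :
    ContDiff ℝ ∞ (fiberAverage f) :=
  contDiff_setIntegral isCompact_Icc hf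

theorem fiberAverage_add {f g : Cover → F} (hf : Continuous f) (hg : Continuous g) (b : Plane) :
    fiberAverage (fun p => f p + g p) b = fiberAverage f b + fiberAverage g b :=
  integral_add (integrableOn_fiber hf b) (integrableOn_fiber hg b)

/-- Vertical derivatives of fiberwise periodic functions average to zero. -/
theorem fiberAverage_fderiv_vertical {f : Cover → F} (hf : ContDiff ℝ ∞ f)
    (hper : ∀ (i : Fin 2) (p : Cover), f (p + ver i) = f p) (b y : Plane) :
    fiberAverage (fun p => fderiv ℝ f p (0, y)) b = 0 := by
  have h1 : ContDiff ℝ ∞ fun t : Plane => f (b, t) :=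
    hf.comp (contDiff_const.prodMk contDiff_id)
  have h2 := setIntegral_fderiv_eq_zero_of_periodic (h1.of_le (by simp))
    (periodic_of_generators (f := fun t => f (b, t)) fun i x => by
      simpa [ver] using hper i (b, x)) y
  rw [← h2]
  refine fiberAverage_congr (g := fun p => fderiv ℝ (fun t : Plane => f (b, t)) p.2 y)
    (fun t => ?_)
  have h3 : HasFDerivAt (fun t : Plane => f (b, t)) (fderiv ℝ f (b, t) ∘L .inr ℝ Plane Plane) t :=
    (hf.differentiable (by simp) (b, t)).hasFDerivAt.comp t (hasFDerivAt_prodMk_right b t)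
  rw [h3.fderiv]
  rfl

variable [CompleteSpace F]
  [NormedAddCommGroup G] [NormedSpace ℝ G] [CompleteSpace G]

theorem map_fiberAverage (L : F →L[ℝ] G) {f : Cover → F} (hf : Continuous f) (b : Plane) :
    L (fiberAverage f b) = fiberAverage (fun p => L (f p)) b :=
  (L.integral_comp_comm (integrableOn_fiber hf b)).symm

theorem fiberAverage_const (c : F) (b : Plane) : fiberAverage (fun _ => c) b = c := by
  simp [fiberAverage, Measure.real, Real.volume_Icc_pi]

theorem fderiv_fiberAverage {f : Cover → F} (hf : ContDiff ℝ ∞ f) (b w : Plane) :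
    fderiv ℝ (fiberAverage f) b w = fiberAverage (fun p => fderiv ℝ f p (w, 0)) b := by
  have h := (hasFDerivAt_setIntegral_of_contDiffOn isOpen_univ
    (isCompact_Icc (a := (0 : Plane)) (b := 1)) hf.contDiffOn (Set.mem_univ b)).fderiv
  have hc : Continuous fun p => fderiv ℝ f p ∘L ContinuousLinearMap.inl ℝ Plane Plane :=
    (hf.continuous_fderiv (by simp)).clm_comp continuous_const
  refine (congrArg (fun T : Plane →L[ℝ] F => T w) h).trans ?_
  exact map_fiberAverage (ContinuousLinearMap.apply ℝ F w) hc b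

end FiberAverage

theorem fderiv_clm_apply_const {E F : Type} [NormedAddCommGroup E] [NormedSpace ℝ E]
    [NormedAddCommGroup F] [NormedSpace ℝ F] {a : E → F →L[ℝ] ℝ} {p : E}
    (ha : DifferentiableAt ℝ a p) (u : E) (v : F) :
    fderiv ℝ (fun q => a q v) p u = fderiv ℝ a p u v :=
  congrArg (fun T : E →L[ℝ] ℝ => T u)
    (((ContinuousLinearMap.apply ℝ ℝ v).hasFDerivAt.comp p ha.hasFDerivAt).fderiv)

/-- Evaluation of bilinear forms at a pair of vectors. -/
def evalPair (u v : Cover) : (Cover →L[ℝ] Cover →L[ℝ] ℝ) →L[ℝ] ℝ :=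
  ContinuousLinearMap.apply ℝ ℝ v ∘L ContinuousLinearMap.apply ℝ (Cover →L[ℝ] ℝ) u

@[simp] theorem evalPair_apply (u v : Cover) (B : Cover →L[ℝ] Cover →L[ℝ] ℝ) :
    evalPair u v B = B u v := rfl

/-- The fiber average of `dβ`, for a fiberwise periodic one-form `β`, is the exterior derivative of
the fiber average of `β`. -/
theorem fiberAverage_curl {β : Cover → Cover →L[ℝ] ℝ} (hβ : ContDiff ℝ ∞ β)
    (hper : ∀ (i : Fin 2) (p : Cover), β (p + ver i) = β p) (b : Plane) (u v : Cover) :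
    fiberAverage (curl β) b u v
      = fderiv ℝ (fiberAverage β) b u.1 v - fderiv ℝ (fiberAverage β) b v.1 u := by
  have key : ∀ u v : Cover, fiberAverage (fun p => fderiv ℝ β p u v) b
      = fderiv ℝ (fiberAverage β) b u.1 v := by
    intro u v
    have hc : Continuous (fderiv ℝ β) := hβ.continuous_fderiv (by simp)
    have h1 : ∀ y : Cover, Continuous fun p => fderiv ℝ β p y := fun y =>
      hc.clm_apply continuous_const
    have h2 : fiberAverage (fun p => fderiv ℝ β p u) b = fderiv ℝ (fiberAverage β) b u.1 := by
      rw [fderiv_fiberAverage hβ, ← add_zero (fiberAverage (fun p => fderiv ℝ β p (u.1, 0)) b),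
        ← fiberAverage_fderiv_vertical hβ hper b u.2, ← fiberAverage_add (h1 _) (h1 _)]
      refine fiberAverage_congr fun t => ?_
      rw [← map_add]; congr 1; ext i <;> simp
    rw [← h2]
    exact (map_fiberAverage (ContinuousLinearMap.apply ℝ ℝ v) (h1 u) b).symm
  have h := map_fiberAverage (evalPair u v) (f := curl β) (continuous_curl hβ) b
  rw [evalPair_apply] at h
  have hcc : ∀ u v : Cover, Continuous fun p => fderiv ℝ β p u v := fun u v =>
    ((hβ.continuous_fderiv (by simp)).clm_apply continuous_const).clm_apply continuous_const
  rw [h, ← key, ← key]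
  exact integral_sub (integrableOn_fiber (hcc u v) b) (integrableOn_fiber (hcc v u) b)

/-! ### The trace of a connection -/

/-- The imaginary part of the trace. -/
def imTrace : Mat →L[ℝ] ℝ :=
  Complex.imCLM ∘L (Matrix.traceLinearMap (Fin 2) ℝ ℂ).toContinuousLinearMap

@[simp] theorem imTrace_apply (m : Mat) : imTrace m = (Matrix.trace m).im := rfl

namespace UTwoConnection

variable {E : UTwoBundle}

/-- The trace of a unitary connection, divided by `i`: a real one-form on the universal cover. -/
def traceForm (Ξ : UTwoConnection E) (p : Cover) : Cover →L[ℝ] ℝ := imTrace ∘L Ξ.A p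

theorem traceForm_apply (Ξ : UTwoConnection E) (p v : Cover) :
    Ξ.traceForm p v = (Matrix.trace (Ξ.A p v)).im := rfl

theorem contDiff_traceForm (Ξ : UTwoConnection E) : ContDiff ℝ ∞ Ξ.traceForm :=
  contDiff_const.clm_comp Ξ.A_smooth

theorem trace_A (Ξ : UTwoConnection E) (p v : Cover) :
    Matrix.trace (Ξ.A p v) = Complex.I * (Ξ.traceForm p v : ℂ) := by
  have h := congrArg (fun m => (Matrix.trace m).re) (Ξ.A_skew p v)
  simp only [Matrix.trace_conjTranspose, Matrix.trace_neg, Complex.neg_re] at h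
  have h2 : (star (Matrix.trace (Ξ.A p v))).re = (Matrix.trace (Ξ.A p v)).re := rfl
  rw [h2] at h
  apply Complex.ext
  · simp only [Complex.mul_re, Complex.I_re, Complex.I_im, Complex.ofReal_re, Complex.ofReal_im]
    linarith
  · simp [traceForm_apply]

theorem imTrace_curvature (Ξ : UTwoConnection E) (p u v : Cover) :
    imTrace (Ξ.curvature p u v) = curl Ξ.traceForm p u v := by
  have h : ∀ u v, fderiv ℝ Ξ.traceForm p u v = imTrace (fderiv ℝ Ξ.A p u v) := by
    intro u v
    have h1 : HasFDerivAt Ξ.traceForm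
        ((ContinuousLinearMap.compL ℝ Cover Mat ℝ imTrace) ∘L fderiv ℝ Ξ.A p) p :=
      (ContinuousLinearMap.compL ℝ Cover Mat ℝ imTrace).hasFDerivAt.comp p
        (Ξ.A_smooth.differentiable (by simp) p).hasFDerivAt
    rw [h1.fderiv]; rfl
  rw [curl_apply, h, h, curvature, map_add, map_sub]
  have h2 : imTrace (Ξ.A p u * Ξ.A p v - Ξ.A p v * Ξ.A p u) = 0 := by
    rw [imTrace_apply, Matrix.trace_sub, Matrix.trace_mul_comm]; simp
  rw [h2, add_zero]

/-- The difference of two connections is an endomorphism-valued form, so its trace is a form on the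
total space. -/
theorem traceForm_sub_periodic (Ξ Ξ' : UTwoConnection E) (γ : Deck) (p : Cover) :
    Ξ.traceForm (p + γ.shift) - Ξ'.traceForm (p + γ.shift) = Ξ.traceForm p - Ξ'.traceForm p := by
  refine ContinuousLinearMap.ext fun v => ?_
  have hu := (Matrix.mem_unitaryGroup_iff (A := E.e γ p)).1 (E.e_unitary γ p)
  have hu' := (Matrix.mem_unitaryGroup_iff' (A := E.e γ p)).1 (E.e_unitary γ p)
  have h : (Ξ.A (p + γ.shift) v - Ξ'.A (p + γ.shift) v) * E.e γ p
      = E.e γ p * (Ξ.A p v - Ξ'.A p v) := by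
    rw [sub_mul, Ξ.A_equivariant, Ξ'.A_equivariant, mul_sub]; abel
  have h2 : Ξ.A (p + γ.shift) v - Ξ'.A (p + γ.shift) v
      = E.e γ p * (Ξ.A p v - Ξ'.A p v) * star (E.e γ p) := by
    rw [← h, mul_assoc, hu, mul_one]
  have h3 := congrArg Matrix.trace h2
  rw [Matrix.trace_mul_comm, ← mul_assoc, hu', one_mul, Matrix.trace_sub, Matrix.trace_sub] at h3
  have h4 := congrArg Complex.im h3
  simpa only [_root_.sub_apply, traceForm_apply, Complex.sub_im] using h4

/-- Under a deck transformation the trace form changes by the logarithmic derivative of the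
determinant of the factor of automorphy. -/
theorem traceForm_shift (Ξ : UTwoConnection E) (γ : Deck) {θ : Cover → ℝ} (hθ : ContDiff ℝ ∞ θ)
    (hdet : ∀ p, (E.e γ p).det = Complex.exp (Complex.I * (θ p : ℂ))) (p : Cover) :
    Ξ.traceForm (p + γ.shift) = Ξ.traceForm p - fderiv ℝ θ p := by
  refine ContinuousLinearMap.ext fun v => ?_
  set e := E.e γ p with he
  set d := fderiv ℝ (E.e γ) p v with hd
  have hu := (Matrix.mem_unitaryGroup_iff (A := e)).1 (E.e_unitary γ p)
  have hu' := (Matrix.mem_unitaryGroup_iff' (A := e)).1 (E.e_unitary γ p)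
  have h2 : Ξ.A (p + γ.shift) v = e * Ξ.A p v * star e - d * star e := by
    rw [← sub_mul, ← Ξ.A_equivariant, mul_assoc, hu, mul_one]
  have h3 := congrArg Matrix.trace h2
  rw [Matrix.trace_sub, Matrix.trace_mul_comm (e * _), ← mul_assoc, hu', one_mul] at h3
  -- Jacobi's formula
  have hent : ∀ i j, HasFDerivAt (fun q => E.e γ q i j)
      ((Matrix.entryLinearMap ℝ ℂ i j).toContinuousLinearMap ∘L fderiv ℝ (E.e γ) p) p :=
    fun i j => (Matrix.entryLinearMap ℝ ℂ i j).toContinuousLinearMap.hasFDerivAt.comp p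
      ((E.e_smooth γ).differentiable (by simp) p).hasFDerivAt
  have hdd := ((hent 0 0).mul (hent 1 1)).sub ((hent 0 1).mul (hent 1 0))
  have hdd0 : HasFDerivAt (fun q => Complex.exp (Complex.I * (θ q : ℂ))) _ p :=
    ((Complex.ofRealCLM.hasFDerivAt.comp p
      (hθ.differentiable (by simp) p).hasFDerivAt).const_mul Complex.I).cexp
  have hdd' := hdd0.congr_of_eventuallyEq (f₁ := fun q => (E.e γ q).det)
    (Eventually.of_forall hdet)
  have hdd2 := DFunLike.congr_fun (hdd'.unique (f := fun q => (E.e γ q).det)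
    (hdd.congr_of_eventuallyEq (Eventually.of_forall fun q => by
      simp only [Matrix.det_fin_two]; rfl))) v
  have hJ : e.det * (Complex.I * (fderiv ℝ θ p v : ℂ)) =
      e 0 0 * d 1 1 + e 1 1 * d 0 0 - (e 0 1 * d 1 0 + e 1 0 * d 0 1) := by
    rw [he, hdet]
    exact hdd2
  have hadj : e.det • star e = e.adjugate := by
    calc e.det • star e = (e.adjugate * e) * star e := by
          rw [Matrix.adjugate_mul, smul_mul_assoc, one_mul]
      _ = _ := by rw [mul_assoc, hu, mul_one]
  have hne : e.det ≠ 0 := by rw [he, hdet]; exact Complex.exp_ne_zero _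
  have htr : Matrix.trace (d * star e) = Complex.I * (fderiv ℝ θ p v : ℂ) := by
    apply mul_left_cancel₀ hne
    have h5 : e.det * Matrix.trace (d * star e) = Matrix.trace (d * (e.det • star e)) := by
      rw [mul_smul_comm, Matrix.trace_smul, smul_eq_mul]
    rw [hJ, h5, hadj, Matrix.adjugate_fin_two]
    simp [Matrix.trace_fin_two, Matrix.mul_apply, Fin.sum_univ_two]
    ring
  rw [htr] at h3
  have h4 := congrArg Complex.im h3
  simpa [traceForm_apply] using h4

end UTwoConnection

/-! ### Integral identities on the two-torus -/

section TorusIntegrals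

/-- A doubly periodic divergence integrates to zero over the unit square. -/
theorem setIntegral_divergence_eq_zero {u₀ u₁ : Plane → ℝ} (h₀ : ContDiff ℝ 1 u₀)
    (h₁ : ContDiff ℝ 1 u₁)
    (p₀ : ∀ (i : Fin 2) (x : Plane), u₀ (x + Pi.single i 1) = u₀ x)
    (p₁ : ∀ (i : Fin 2) (x : Plane), u₁ (x + Pi.single i 1) = u₁ x) (v w : Plane) :
    ∫ x in Set.Icc (0 : Plane) 1, (fderiv ℝ u₀ x v + fderiv ℝ u₁ x w) = 0 := by
  rw [integral_add, setIntegral_fderiv_eq_zero_of_periodic h₀ (periodic_of_generators p₀),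
    setIntegral_fderiv_eq_zero_of_periodic h₁ (periodic_of_generators p₁), add_zero]
  · exact ((h₀.continuous_fderiv (by simp)).clm_apply continuous_const).integrableOn_Icc
  · exact ((h₁.continuous_fderiv (by simp)).clm_apply continuous_const).integrableOn_Icc

theorem forall_pos_or_forall_neg {g : Plane → ℝ} (hg : Continuous g) (h : ∀ x, g x ≠ 0) :
    (∀ x, 0 < g x) ∨ ∀ x, g x < 0 := by
  by_contra hcon
  push Not at hcon
  obtain ⟨⟨x, hx⟩, y, hy⟩ := hcon
  obtain ⟨z, -, hz⟩ := isPreconnected_univ.intermediate_value (Set.mem_univ x) (Set.mem_univ y)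
    hg.continuousOn ⟨hx, hy⟩
  exact h z hz

theorem setIntegral_ne_zero_of_periodic {g : Plane → ℝ} (hg : Continuous g) (h : ∀ x, g x ≠ 0)
    (hper : ∀ (i : Fin 2) (x : Plane), g (x + Pi.single i 1) = g x) :
    ∫ x in Set.Icc (0 : Plane) 1, g x ≠ 0 := by
  intro h0
  rcases forall_pos_or_forall_neg hg h with hp | hp
  · exact h 0 (eq_zero_of_setIntegral_eq_zero_of_periodic hg (periodic_of_generators hper)
      (fun x => (hp x).le) h0 0)
  · refine h 0 (neg_eq_zero.1 (eq_zero_of_setIntegral_eq_zero_of_periodic (g := fun x => -g x)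
      hg.neg (periodic_of_generators (f := fun x => -g x) fun i x => by simp only [hper])
      (fun x => by linarith [hp x]) ?_ 0))
    rw [integral_neg, h0, neg_zero]

/-- A symmetric form that is trace free with respect to a positive definite one has nonpositive
determinant, and it vanishes if its determinant does. -/
theorem det_nonpos_of_traceFree {G₀₀ G₀₁ G₁₁ S₀₀ S₀₁ S₁₁ : ℝ} (hG : 0 < G₀₀)
    (hdet : 0 < G₀₀ * G₁₁ - G₀₁ ^ 2) (htr : G₀₀ * S₁₁ - 2 * (G₀₁ * S₀₁) + G₁₁ * S₀₀ = 0) :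
    S₀₀ * S₁₁ - S₀₁ ^ 2 ≤ 0 ∧ (S₀₀ * S₁₁ - S₀₁ ^ 2 = 0 → S₀₀ = 0 ∧ S₀₁ = 0 ∧ S₁₁ = 0) := by
  have key : G₀₀ ^ 2 * (S₀₀ * S₁₁ - S₀₁ ^ 2)
      = -(G₀₀ * S₀₁ - G₀₁ * S₀₀) ^ 2 - (G₀₀ * G₁₁ - G₀₁ ^ 2) * S₀₀ ^ 2 := by
    linear_combination (G₀₀ * S₀₀) * htr
  have h2 : 0 < G₀₀ ^ 2 := by positivity
  have h3 : 0 ≤ (G₀₀ * G₁₁ - G₀₁ ^ 2) * S₀₀ ^ 2 := by positivity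
  refine ⟨?_, fun h => ?_⟩
  · by_contra hc
    push Not at hc
    nlinarith [mul_pos h2 hc, sq_nonneg (G₀₀ * S₀₁ - G₀₁ * S₀₀)]
  · rw [h, mul_zero] at key
    have h5 : (G₀₀ * G₁₁ - G₀₁ ^ 2) * S₀₀ ^ 2 = 0 := by
      nlinarith [sq_nonneg (G₀₀ * S₀₁ - G₀₁ * S₀₀)]
    have hS₀ : S₀₀ = 0 := by
      rcases mul_eq_zero.1 h5 with h6 | h6
      · linarith
      · exact pow_eq_zero_iff (two_ne_zero) |>.1 h6
    have hS₁ : S₀₁ = 0 := by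
      have h7 : (G₀₀ * S₀₁ - G₀₁ * S₀₀) ^ 2 = 0 := by nlinarith
      rw [hS₀, mul_zero, sub_zero] at h7
      rcases mul_eq_zero.1 (pow_eq_zero_iff (two_ne_zero) |>.1 h7) with h8 | h8
      · linarith
      · exact h8
    refine ⟨hS₀, hS₁, ?_⟩
    rw [hS₀, hS₁] at htr
    rcases mul_eq_zero.1 (by linarith : G₀₀ * S₁₁ = 0) with h8 | h8
    · linarith
    · exact h8

/-- The differential `M = dg` of a doubly periodic map `g = (g₀, g₁)` vanishes if it satisfies the
linear elliptic system expressing that `∑ ∂ᵢ gⱼ dbᵢ ∧ dxⱼ` is of type `(1,1)` (here: `M N` is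
symmetric) with contraction a constant `k` (the polarized determinant of `P` and `M` is
`k det P`). -/
theorem fderiv_eq_zero_of_primitive
    {P₀₀ P₀₁ P₁₀ P₁₁ N₀₀ N₀₁ N₁₀ N₁₁ g₀ g₁ : Plane → ℝ}
    (hP : ContDiff ℝ ∞ P₀₀ ∧ ContDiff ℝ ∞ P₀₁ ∧ ContDiff ℝ ∞ P₁₀ ∧ ContDiff ℝ ∞ P₁₁)
    (hN : Continuous N₀₀ ∧ Continuous N₀₁ ∧ Continuous N₁₀ ∧ Continuous N₁₁)
    (hg₀ : ContDiff ℝ ∞ g₀) (hg₁ : ContDiff ℝ ∞ g₁)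
    (hPp : ∀ (i : Fin 2) (x : Plane), P₀₀ (x + Pi.single i 1) = P₀₀ x ∧
      P₀₁ (x + Pi.single i 1) = P₀₁ x ∧ P₁₀ (x + Pi.single i 1) = P₁₀ x ∧
      P₁₁ (x + Pi.single i 1) = P₁₁ x)
    (hgp : ∀ (i : Fin 2) (x : Plane), g₀ (x + Pi.single i 1) = g₀ x ∧
      g₁ (x + Pi.single i 1) = g₁ x) (v w : Plane)
    (hcl : ∀ x, fderiv ℝ P₁₀ x v = fderiv ℝ P₀₀ x w ∧ fderiv ℝ P₁₁ x v = fderiv ℝ P₀₁ x w)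
    (hGs : ∀ x, P₀₀ x * N₀₁ x + P₀₁ x * N₁₁ x = P₁₀ x * N₀₀ x + P₁₁ x * N₁₀ x)
    (hGp : ∀ x, 0 < P₀₀ x * N₀₀ x + P₀₁ x * N₁₀ x)
    (hGd : ∀ x, 0 < (P₀₀ x * P₁₁ x - P₀₁ x * P₁₀ x) * (N₀₀ x * N₁₁ x - N₀₁ x * N₁₀ x))
    (hS : ∀ x, fderiv ℝ g₀ x v * N₀₁ x + fderiv ℝ g₁ x v * N₁₁ x
      = fderiv ℝ g₀ x w * N₀₀ x + fderiv ℝ g₁ x w * N₁₀ x)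
    {k : ℝ} (hk : ∀ x, P₀₀ x * fderiv ℝ g₁ x w - P₀₁ x * fderiv ℝ g₀ x w
      - P₁₀ x * fderiv ℝ g₁ x v + P₁₁ x * fderiv ℝ g₀ x v
      = k * (P₀₀ x * P₁₁ x - P₀₁ x * P₁₀ x)) (x : Plane) :
    fderiv ℝ g₀ x v = 0 ∧ fderiv ℝ g₀ x w = 0 ∧ fderiv ℝ g₁ x v = 0 ∧ fderiv ℝ g₁ x w = 0 := by
  obtain ⟨h₀₀, h₀₁, h₁₀, h₁₁⟩ := hP
  obtain ⟨n₀₀, n₀₁, n₁₀, n₁₁⟩ := hN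
  have hmul : ∀ {f g : Plane → ℝ}, ContDiff ℝ ∞ f → ContDiff ℝ ∞ g → ∀ x u,
      fderiv ℝ (fun x => f x * g x) x u = f x * fderiv ℝ g x u + g x * fderiv ℝ f x u := by
    intro f g hf hg x u
    rw [fderiv_fun_mul (hf.differentiable (by simp) x) (hg.differentiable (by simp) x)]
    simp
  have hsub : ∀ {f g : Plane → ℝ}, ContDiff ℝ ∞ f → ContDiff ℝ ∞ g → ∀ x u,
      fderiv ℝ (fun x => f x - g x) x u = fderiv ℝ f x u - fderiv ℝ g x u := by
    intro f g hf hg x u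
    rw [fderiv_fun_sub (hf.differentiable (by simp) x) (hg.differentiable (by simp) x)]
    simp
  have hPdet : ∀ x, P₀₀ x * P₁₁ x - P₀₁ x * P₁₀ x ≠ 0 := fun x h => by
    have := hGd x; rw [h, zero_mul] at this; exact lt_irrefl _ this
  have hNdet : ∀ x, N₀₀ x * N₁₁ x - N₀₁ x * N₁₀ x ≠ 0 := fun x h => by
    have := hGd x; rw [h, mul_zero] at this; exact lt_irrefl _ this
  -- the contraction is a divergence, hence `k = 0`
  have hk0 : k = 0 := by
    have h := setIntegral_divergence_eq_zero
      (u₀ := fun x => P₁₁ x * g₀ x - P₁₀ x * g₁ x) (u₁ := fun x => P₀₀ x * g₁ x - P₀₁ x * g₀ x)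
      (((h₁₁.mul hg₀).sub (h₁₀.mul hg₁)).of_le (by simp))
      (((h₀₀.mul hg₁).sub (h₀₁.mul hg₀)).of_le (by simp))
      (fun i x => by simp only [hPp i x, hgp i x]) (fun i x => by simp only [hPp i x, hgp i x]) v w
    have h2 : ∀ x, fderiv ℝ (fun x => P₁₁ x * g₀ x - P₁₀ x * g₁ x) x v
        + fderiv ℝ (fun x => P₀₀ x * g₁ x - P₀₁ x * g₀ x) x w
        = k * (P₀₀ x * P₁₁ x - P₀₁ x * P₁₀ x) := by
      intro x
      rw [hsub (h₁₁.mul hg₀) (h₁₀.mul hg₁), hsub (h₀₀.mul hg₁) (h₀₁.mul hg₀), hmul h₁₁ hg₀,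
        hmul h₁₀ hg₁, hmul h₀₀ hg₁, hmul h₀₁ hg₀, (hcl x).1, (hcl x).2, ← hk x]
      ring
    simp only [h2, integral_const_mul] at h
    refine (mul_eq_zero.1 h).resolve_right (setIntegral_ne_zero_of_periodic
      (((h₀₀.mul h₁₁).sub (h₀₁.mul h₁₀)).continuous) hPdet fun i x => by simp only [hPp i x])
  set S₀₀ : Plane → ℝ := fun x => fderiv ℝ g₀ x v * N₀₀ x + fderiv ℝ g₁ x v * N₁₀ x with hS₀₀
  set S₀₁ : Plane → ℝ := fun x => fderiv ℝ g₀ x v * N₀₁ x + fderiv ℝ g₁ x v * N₁₁ x with hS₀₁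
  set S₁₁ : Plane → ℝ := fun x => fderiv ℝ g₀ x w * N₀₁ x + fderiv ℝ g₁ x w * N₁₁ x with hS₁₁
  set D : Plane → ℝ := fun x => fderiv ℝ g₀ x v * fderiv ℝ g₁ x w
    - fderiv ℝ g₁ x v * fderiv ℝ g₀ x w with hD
  have hSdet : ∀ x, S₀₀ x * S₁₁ x - S₀₁ x ^ 2 = D x * (N₀₀ x * N₁₁ x - N₀₁ x * N₁₀ x) := fun x => by
    simp only [hS₀₀, hS₀₁, hS₁₁, hD]
    linear_combination (-(fderiv ℝ g₀ x v * N₀₁ x + fderiv ℝ g₁ x v * N₁₁ x)) * hS x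
  have hmain := fun x => det_nonpos_of_traceFree (G₀₁ := P₀₀ x * N₀₁ x + P₀₁ x * N₁₁ x)
    (G₁₁ := P₁₀ x * N₀₁ x + P₁₁ x * N₁₁ x) (S₀₀ := S₀₀ x) (S₀₁ := S₀₁ x) (S₁₁ := S₁₁ x) (hGp x)
    (by
      have h1 := hGd x
      have h2 : (P₀₀ x * P₁₁ x - P₀₁ x * P₁₀ x) * (N₀₀ x * N₁₁ x - N₀₁ x * N₁₀ x) =
        (P₀₀ x * N₀₀ x + P₀₁ x * N₁₀ x) * (P₁₀ x * N₀₁ x + P₁₁ x * N₁₁ x)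
          - (P₀₀ x * N₀₁ x + P₀₁ x * N₁₁ x) ^ 2 := by
        linear_combination (P₀₀ x * N₀₁ x + P₀₁ x * N₁₁ x) * hGs x
      rwa [h2] at h1)
    (by
      have h1 := hk x
      rw [hk0, zero_mul] at h1
      simp only [hS₀₀, hS₀₁, hS₁₁]
      linear_combination (N₀₀ x * N₁₁ x - N₀₁ x * N₁₀ x) * h1
        - (P₀₀ x * N₀₁ x + P₀₁ x * N₁₁ x) * hS x
        - (fderiv ℝ g₀ x v * N₀₁ x + fderiv ℝ g₁ x v * N₁₁ x) * hGs x)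
  have hfg : ∀ {g : Plane → ℝ}, ContDiff ℝ ∞ g → ∀ u, ContDiff ℝ ∞ fun x => fderiv ℝ g x u :=
    fun hg u => (hg.fderiv_right (m := ∞) (by simp)).clm_apply contDiff_const
  have hfp : ∀ {g : Plane → ℝ}, (∀ (i : Fin 2) x, g (x + Pi.single i 1) = g x) →
      ∀ (u : Plane) (i : Fin 2) x, fderiv ℝ g (x + Pi.single i 1) u = fderiv ℝ g x u := by
    intro g hg u i x
    rw [← fderiv_comp_add_right]; simp only [hg]
  have hp₀ := hfp fun i x => (hgp i x).1
  have hp₁ := hfp fun i x => (hgp i x).2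
  -- `det M` is a divergence
  have hDint : ∫ x in Set.Icc (0 : Plane) 1, D x = 0 := by
    have h := setIntegral_divergence_eq_zero
      (u₀ := fun x => g₀ x * fderiv ℝ g₁ x w) (u₁ := fun x => (-g₀ x) * fderiv ℝ g₁ x v)
      ((hg₀.mul (hfg hg₁ w)).of_le (by simp)) ((hg₀.neg.mul (hfg hg₁ v)).of_le (by simp))
      (fun i x => by simp only [hgp i x, hp₁]) (fun i x => by simp only [hgp i x, hp₁]) v w
    rw [← h]
    refine integral_congr_ae (ae_of_all _ fun x => ?_)
    have hsymm : fderiv ℝ (fun y => fderiv ℝ g₁ y w) x v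
        = fderiv ℝ (fun y => fderiv ℝ g₁ y v) x w := by
      have hd : DifferentiableAt ℝ (fderiv ℝ g₁) x :=
        (hg₁.fderiv_right (m := ∞) (by simp)).differentiable (by simp) x
      rw [fderiv_clm_apply_const hd, fderiv_clm_apply_const hd]
      exact (hg₁.contDiffAt.isSymmSndFDerivAt (by
        rw [minSmoothness_of_isRCLikeNormedField]
        exact WithTop.coe_le_coe.2 (le_top (a := (2 : ℕ∞))))) v w
    have hneg : fderiv ℝ (fun x => -g₀ x) x w = -fderiv ℝ g₀ x w := by
      rw [fderiv_fun_neg]; rfl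
    simp only [hD]
    rw [hmul hg₀ (hfg hg₁ w), hmul hg₀.neg (hfg hg₁ v), hsymm, hneg]
    ring
  have hDc : Continuous D :=
    (((hfg hg₀ v).mul (hfg hg₁ w)).sub ((hfg hg₁ v).mul (hfg hg₀ w))).continuous
  have hDp : ∀ (i : Fin 2) (x : Plane), D (x + Pi.single i 1) = D x := fun i x => by
    simp only [hD, hp₀, hp₁]
  have hD0 : ∀ x, D x = 0 := by
    rcases forall_pos_or_forall_neg ((n₀₀.mul n₁₁).sub (n₀₁.mul n₁₀)) hNdet with hp | hp
    · intro x
      refine neg_eq_zero.1 (eq_zero_of_setIntegral_eq_zero_of_periodic (g := fun x => -D x)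
        hDc.neg (periodic_of_generators (f := fun x => -D x) fun i x => by simp only [hDp])
        (fun x => ?_) ?_ x)
      · have h1 := (hmain x).1
        rw [hSdet] at h1
        have := nonpos_of_mul_nonpos_left h1 (hp x)
        linarith
      · rw [integral_neg, hDint, neg_zero]
    · refine eq_zero_of_setIntegral_eq_zero_of_periodic hDc (periodic_of_generators hDp)
        (fun x => ?_) hDint
      have h1 := (hmain x).1
      rw [hSdet] at h1
      by_contra hc
      push Not at hc
      exact absurd h1 (not_le.2 (mul_pos_of_neg_of_neg hc (hp x)))
  obtain ⟨e₀₀, e₀₁, e₁₁⟩ := (hmain x).2 (by rw [hSdet, hD0, zero_mul])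
  have e₁₀ := (hS x).symm.trans e₀₁
  simp only [hS₀₀, hS₀₁, hS₁₁] at e₀₀ e₀₁ e₁₁
  have hn := hNdet x
  refine ⟨?_, ?_, ?_, ?_⟩ <;> apply (mul_eq_zero.1 _).resolve_right hn
  · linear_combination N₁₁ x * e₀₀ - N₁₀ x * e₀₁
  · linear_combination N₁₁ x * e₁₀ - N₁₀ x * e₁₁
  · linear_combination N₀₀ x * e₀₁ - N₀₁ x * e₀₀
  · linear_combination N₀₀ x * e₁₁ - N₀₁ x * e₁₀

end TorusIntegrals

/-! ### Kähler structures invariant along the fibers -/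

section TwoForms

theorem altTwo_swap (f : Cover [⋀^Fin 2]→L[ℝ] ℝ) (u v : Cover) : f ![v, u] = -f ![u, v] := by
  have h := f.toAlternatingMap.map_swap ![u, v] (show (0 : Fin 2) ≠ 1 by decide)
  have h2 : ![u, v] ∘ Equiv.swap (0 : Fin 2) 1 = ![v, u] := by
    ext i : 1
    fin_cases i <;> simp
  rw [h2] at h
  exact h

theorem altTwo_combo_left (f : Cover [⋀^Fin 2]→L[ℝ] ℝ) (a c : ℝ) (u v w : Cover) :
    f ![a • u + c • v, w] = a * f ![u, w] + c * f ![v, w] := by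
  have h := congrArg (fun g => g ![w]) ((f.curryLeft.map_add (a • u) (c • v)).trans
    (congrArg₂ (· + ·) (f.curryLeft.map_smul a u) (f.curryLeft.map_smul c v)))
  exact h

theorem altTwo_combo_right (f : Cover [⋀^Fin 2]→L[ℝ] ℝ) (a c : ℝ) (u v w : Cover) :
    f ![w, a • u + c • v] = a * f ![w, u] + c * f ![w, v] := by
  rw [altTwo_swap, altTwo_combo_left, altTwo_swap f w u, altTwo_swap f w v]; ring

theorem vertical_eq (y : Plane) : ((0, y) : Cover) = y 0 • ver 0 + y 1 • ver 1 := by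
  ext i
  · simp [ver]
  · fin_cases i <;> simp [ver]

theorem horizontal_eq (w : Plane) : ((w, 0) : Cover) = w 0 • hor 0 + w 1 • hor 1 := by
  ext i
  · fin_cases i <;> simp [hor]
  · simp [hor]

end TwoForms

namespace KahlerT2Structure

variable (K : KahlerT2Structure)

/-- The linear map `N(b)` with `J (w, 0) = (0, N(b) w)`. -/
def fiberJ (b : Plane) : Plane →L[ℝ] Plane :=
  .snd ℝ Plane Plane ∘L K.J (b, 0) ∘L .inl ℝ Plane Plane

theorem J_hor (b x w : Plane) : K.J (b, x) (w, 0) = (0, K.fiberJ b w) := by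
  have h := K.J_invariant b 0 x
  rw [zero_add] at h
  rw [h]
  exact Prod.ext (K.J_zeroSection b w) rfl

theorem J_fiberJ (b x w : Plane) : K.J (b, x) (0, K.fiberJ b w) = -(w, 0) := by
  rw [← K.J_hor b x, K.J_sq]

theorem form_fiber (b x : Plane) : K.form (b, x) = K.form (b, 0) := by
  have h := K.form_invariant b 0 x
  rwa [zero_add] at h

theorem JScaled_hor (ε : ℝ) (b x w : Plane) :
    K.JScaled ε (b, x) (w, 0) = ε⁻¹ • ((0, K.fiberJ b w) : Cover) := by
  rw [← K.J_hor b x]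
  have h : ((0, 0) : Cover) = 0 := rfl
  simp [JScaled, h]

theorem JScaled_fiberJ (ε : ℝ) (b x w : Plane) :
    K.JScaled ε (b, x) (0, K.fiberJ b w) = -ε • ((w, 0) : Cover) := by
  have h := K.J_fiberJ b x w
  have h2 : K.JScaled ε (b, x) (0, K.fiberJ b w) = ε • K.J (b, x) (0, K.fiberJ b w) := by
    simp only [JScaled, _root_.add_apply, _root_.smul_apply,
      ContinuousLinearMap.comp_apply, ContinuousLinearMap.coe_fst', ContinuousLinearMap.coe_snd',
      map_zero, smul_zero, zero_add, ContinuousLinearMap.inr_apply]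
  rw [h2, h, smul_neg, neg_smul]

/-- The matrix of `N(b)`. -/
def fiberJMat (i j : Fin 2) (b : Plane) : ℝ := K.fiberJ b (Pi.single j 1) i

/-- The matrix `P(b)` of the pairing of horizontal with vertical vectors given by the Kähler
form. -/
def pairing (i j : Fin 2) (b : Plane) : ℝ := K.form (b, 0) ![hor i, ver j]

theorem fiberJ_single (j : Fin 2) (b : Plane) :
    ((0, K.fiberJ b (Pi.single j 1)) : Cover)
      = K.fiberJMat 0 j b • ver 0 + K.fiberJMat 1 j b • ver 1 :=
  vertical_eq _

theorem contDiff_pairing (i j : Fin 2) : ContDiff ℝ ∞ (K.pairing i j) := by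
  have h : ContDiff ℝ ∞ fun b : Plane => K.form (b, 0) :=
    K.form_smooth.comp (contDiff_id.prodMk contDiff_const)
  exact (ContinuousAlternatingMap.apply ℝ Cover ℝ ![hor i, ver j]).contDiff.comp h

theorem continuous_fiberJMat (i j : Fin 2) : Continuous (K.fiberJMat i j) := by
  have h : Continuous fun b : Plane => (K.J (b, 0) (Pi.single j 1, 0)).2 i :=
    (continuous_apply i).comp (continuous_snd.comp
      ((K.J_smooth.continuous.comp (by fun_prop)).clm_apply continuous_const))
  exact h

theorem shift_base (i : Fin 2) (b : Plane) :
    ((b + Pi.single i 1, 0) : Cover) = (b, 0) + Deck.shift (Pi.single i 1, 0) := by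
  ext j
  · rcases eq_or_ne j i with rfl | h
    · simp [Deck.shift]
    · simp [Deck.shift, h]
  · simp [Deck.shift]

theorem pairing_periodic (i j l : Fin 2) (b : Plane) :
    K.pairing i j (b + Pi.single l 1) = K.pairing i j b := by
  rw [pairing, shift_base, K.form_periodic]; rfl

theorem fiberJMat_periodic (i j l : Fin 2) (b : Plane) :
    K.fiberJMat i j (b + Pi.single l 1) = K.fiberJMat i j b := by
  rw [fiberJMat, fiberJ, shift_base, K.J_periodic]; rfl

/-- The consequence of `dω = 0` for the pairing: its columns are closed one-forms on the base. -/
theorem pairing_closed (j : Fin 2) (b : Plane) :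
    fderiv ℝ (K.pairing 1 j) b (Pi.single 0 1) = fderiv ℝ (K.pairing 0 j) b (Pi.single 1 1) := by
  have hd : DifferentiableAt ℝ K.form (b, 0) := K.form_smooth.differentiable (by simp) _
  have h := congrArg (fun f : Cover → Cover [⋀^Fin 3]→L[ℝ] ℝ => f (b, 0) ![hor 0, hor 1, ver j])
    K.form_closed
  have h0 : extDeriv K.form (b, 0) ![hor 0, hor 1, ver j] = 0 := h
  rw [extDeriv_apply hd, Fin.sum_univ_three] at h0
  have r0 : Fin.removeNth (0 : Fin 3) ![hor 0, hor 1, ver j] = ![hor 1, ver j] := by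
    ext i : 1; fin_cases i <;> rfl
  have r1 : Fin.removeNth (1 : Fin 3) ![hor 0, hor 1, ver j] = ![hor 0, ver j] := by
    ext i : 1; fin_cases i <;> rfl
  have r2 : Fin.removeNth (2 : Fin 3) ![hor 0, hor 1, ver j] = ![hor 0, hor 1] := by
    ext i : 1; fin_cases i <;> rfl
  have hz : ∀ p, K.form p ![hor 0, hor 1] = 0 := fun p => by
    rw [show p = (p.1, p.2) from rfl, K.form_fiber]
    exact K.zeroSection_lagrangian _ _ _
  rw [r0, r1, r2] at h0
  simp only [hz] at h0
  have hbase : ∀ i l : Fin 2, fderiv ℝ (fun p => K.form p ![hor i, ver j]) (b, 0) (hor l)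
      = fderiv ℝ (K.pairing i j) b (Pi.single l 1) := by
    intro i l
    have hd2 : DifferentiableAt ℝ (fun p => K.form p ![hor i, ver j]) (b, 0) :=
      ((ContinuousAlternatingMap.apply ℝ Cover ℝ ![hor i, ver j]).differentiableAt).comp _ hd
    have := (HasFDerivAt.comp b (f := fun e : Plane => (e, (0 : Plane))) hd2.hasFDerivAt
      (hasFDerivAt_prodMk_left b (0 : Plane))).fderiv
    exact (congrArg (fun T : Plane →L[ℝ] ℝ => T (Pi.single l 1)) this).symm
  have e0 : (![hor 0, hor 1, ver j] : Fin 3 → Cover) 0 = hor 0 := rfl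
  have e1 : (![hor 0, hor 1, ver j] : Fin 3 → Cover) 1 = hor 1 := rfl
  rw [e0, e1, hbase, hbase] at h0
  simp at h0
  linarith

theorem form_hor_fiberJ (i j : Fin 2) (b : Plane) :
    K.form (b, 0) ![hor i, (0, K.fiberJ b (Pi.single j 1))]
      = K.pairing i 0 b * K.fiberJMat 0 j b + K.pairing i 1 b * K.fiberJMat 1 j b := by
  rw [fiberJ_single, altTwo_combo_right]; simp only [pairing]; ring

/-- The Kähler metric is symmetric on horizontal vectors, where its matrix is `P N`. -/
theorem metric_symm (b : Plane) :
    K.pairing 0 0 b * K.fiberJMat 0 1 b + K.pairing 0 1 b * K.fiberJMat 1 1 b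
      = K.pairing 1 0 b * K.fiberJMat 0 0 b + K.pairing 1 1 b * K.fiberJMat 1 0 b := by
  rw [← form_hor_fiberJ, ← form_hor_fiberJ, ← K.form_J]
  have h1 := K.J_hor b 0 (Pi.single 0 1)
  have h2 := K.J_fiberJ b 0 (Pi.single 1 1)
  rw [show hor 0 = (Pi.single 0 1, 0) from rfl, h1, h2]
  have h3 := altTwo_combo_right (K.form (b, 0)) (-1) 0 (hor 1) 0 (0, K.fiberJ b (Pi.single 0 1))
  rw [smul_zero, add_zero, neg_one_smul, zero_mul, add_zero] at h3
  rw [show -((Pi.single 1 1, 0) : Cover) = -hor 1 from rfl, h3, altTwo_swap]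
  ring

/-- The Kähler metric is positive definite on horizontal vectors: a diagonal entry and the
determinant of `P N` are positive. -/
theorem metric_pos (b : Plane) :
    0 < K.pairing 0 0 b * K.fiberJMat 0 0 b + K.pairing 0 1 b * K.fiberJMat 1 0 b ∧
    0 < (K.pairing 0 0 b * K.pairing 1 1 b - K.pairing 0 1 b * K.pairing 1 0 b)
      * (K.fiberJMat 0 0 b * K.fiberJMat 1 1 b - K.fiberJMat 0 1 b * K.fiberJMat 1 0 b) := by
  have hJ : ∀ j, K.J (b, 0) (hor j) = (0, K.fiberJ b (Pi.single j 1)) := fun j => K.J_hor b 0 _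
  have hne : ∀ w : Plane, w ≠ 0 → 0 < K.form (b, 0) ![(w, 0), K.J (b, 0) (w, 0)] := fun w hw =>
    K.form_pos _ _ fun h => hw (congrArg Prod.fst h)
  have h00 : 0 < K.form (b, 0) ![hor 0, (0, K.fiberJ b (Pi.single 0 1))] := by
    rw [← hJ]
    exact hne _ fun h => by simpa using congrFun h 0
  set G00 := K.form (b, 0) ![hor 0, (0, K.fiberJ b (Pi.single 0 1))] with hG00
  set G01 := K.form (b, 0) ![hor 0, (0, K.fiberJ b (Pi.single 1 1))] with hG01
  have hG : K.form (b, 0) ![hor 1, (0, K.fiberJ b (Pi.single 0 1))] = G01 := by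
    rw [hG01, form_hor_fiberJ, form_hor_fiberJ, metric_symm]
  set G11 := K.form (b, 0) ![hor 1, (0, K.fiberJ b (Pi.single 1 1))] with hG11
  -- positivity on the vector orthogonal to the first coordinate vector
  have hd := hne ![-G01, G00] fun h => by
    have := congrFun h 1
    simp at this; exact h00.ne' this
  rw [horizontal_eq ![-G01, G00], map_add, map_smul, map_smul, hJ, hJ, altTwo_combo_left,
    altTwo_combo_right, altTwo_combo_right, ← hG00, ← hG01, hG, ← hG11] at hd
  simp only [Matrix.cons_val_zero, Matrix.cons_val_one] at hd
  refine ⟨by rw [← form_hor_fiberJ]; exact h00, ?_⟩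
  have h2 : 0 < G00 * (G00 * G11 - G01 ^ 2) := by linarith
  have h3 := (mul_pos_iff_of_pos_left h00).1 h2
  have h4 : G00 * G11 - G01 ^ 2 = G00 * G11 - G01 * G01 := by ring
  rw [h4] at h3
  nth_rewrite 2 [← hG] at h3
  rw [hG00, hG01, hG11, form_hor_fiberJ, form_hor_fiberJ, form_hor_fiberJ, form_hor_fiberJ] at h3
  linarith

end KahlerT2Structure

/-! ### Consequences of the Hermitian-Yang-Mills equations -/

section HermitianYangMills

variable {K : KahlerT2Structure} {ε : ℝ} {E : UTwoBundle} {Ξ : UTwoConnection E}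

theorem IsHermitianYangMills.curl_type (h : IsHermitianYangMills K ε Ξ) (p u v : Cover) :
    curl Ξ.traceForm p (K.JScaled ε p u) (K.JScaled ε p v) = curl Ξ.traceForm p u v := by
  rw [← Ξ.imTrace_curvature, ← Ξ.imTrace_curvature, h.1]

theorem curl_swap (a : Cover → Cover →L[ℝ] ℝ) (p u v : Cover) : curl a p u v = -curl a p v u := by
  simp only [curl_apply]; ring

/-- The mixed part of the trace of the curvature: the parameter `ε` cancels. -/
theorem IsHermitianYangMills.curl_mixed (h : IsHermitianYangMills K ε Ξ) (hε : ε ≠ 0)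
    (b x w w' : Plane) :
    curl Ξ.traceForm (b, x) (w, 0) (0, K.fiberJ b w')
      = curl Ξ.traceForm (b, x) (w', 0) (0, K.fiberJ b w) := by
  rw [← h.curl_type, K.JScaled_hor, K.JScaled_fiberJ, curl_swap]
  simp only [map_smul, _root_.smul_apply, smul_eq_mul]
  field_simp

/-- The horizontal part of the trace of the curvature is determined by the vertical part. -/
theorem IsHermitianYangMills.curl_base (h : IsHermitianYangMills K ε Ξ) (b x w w' : Plane) :
    curl Ξ.traceForm (b, x) (w, 0) (w', 0)
      = (ε⁻¹) ^ 2 * curl Ξ.traceForm (b, x) (0, K.fiberJ b w) (0, K.fiberJ b w') := by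
  rw [← h.curl_type, K.JScaled_hor, K.JScaled_hor]
  simp only [map_smul, _root_.smul_apply, smul_eq_mul]
  ring

theorem IsHermitianYangMills.exists_contraction (h : IsHermitianYangMills K ε Ξ) (hε : ε ≠ 0) :
    ∃ k : ℝ, ∀ b x : Plane,
      K.pairing 0 0 b * curl Ξ.traceForm (b, x) (hor 1) (ver 1)
        - K.pairing 0 1 b * curl Ξ.traceForm (b, x) (hor 1) (ver 0)
        - K.pairing 1 0 b * curl Ξ.traceForm (b, x) (hor 0) (ver 1)
        + K.pairing 1 1 b * curl Ξ.traceForm (b, x) (hor 0) (ver 0)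
      = k * (K.pairing 0 0 b * K.pairing 1 1 b - K.pairing 0 1 b * K.pairing 1 0 b) := by
  obtain ⟨c, hc⟩ := h.2
  refine ⟨4 * c * ε, fun b x => ?_⟩
  have h1 := congrArg imTrace (hc (b, x) (hor 0) (hor 1) (ver 0) (ver 1))
  have hf : ∀ u v, K.formScaled ε (b, x) ![u, v] = ε * K.form (b, 0) ![u, v] := fun u v => by
    rw [← K.form_fiber b x]; rfl
  have hb : K.form (b, 0) ![hor 0, hor 1] = 0 := K.zeroSection_lagrangian _ _ _
  have hv : K.form (b, 0) ![ver 0, ver 1] = 0 := K.fiber_lagrangian _ _ _ _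
  have hp : ∀ i j, K.form (b, 0) ![hor i, ver j] = K.pairing i j b := fun i j => rfl
  simp only [wedgeTwo, hf, hb, hv, hp] at h1
  simp only [map_add, map_sub, map_smul, Ξ.imTrace_curvature, smul_eq_mul, mul_zero, zero_mul,
    zero_sub, add_zero] at h1
  rw [imTrace_apply, Matrix.trace_smul, Matrix.trace_one] at h1
  simp only [Fintype.card_fin, smul_eq_mul, Complex.mul_im, Complex.mul_re, Complex.I_re,
    Complex.I_im, Complex.ofReal_re, Complex.ofReal_im] at h1
  norm_num at h1
  apply mul_left_cancel₀ hε
  linarith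

end HermitianYangMills

/-! ### The averaged trace difference of two connections -/

section Averages

theorem map_fiberAverage_eq_of_forall {F G : Type} [NormedAddCommGroup F] [NormedSpace ℝ F]
    [CompleteSpace F] [NormedAddCommGroup G] [NormedSpace ℝ G] [CompleteSpace G] (L : F →L[ℝ] G)
    {f : Cover → F} (hf : Continuous f) {b : Plane} {c : G} (h : ∀ t, L (f (b, t)) = c) :
    L (fiberAverage f b) = c := by
  rw [map_fiberAverage L hf, fiberAverage_congr (g := fun _ => c) h, fiberAverage_const]

theorem curl_sub {a a' : Cover → Cover →L[ℝ] ℝ} (ha : ContDiff ℝ ∞ a) (ha' : ContDiff ℝ ∞ a')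
    (p u v : Cover) : curl (fun p => a p - a' p) p u v = curl a p u v - curl a' p u v := by
  simp only [curl_apply]
  rw [fderiv_fun_sub (ha.differentiable (by simp) p) (ha'.differentiable (by simp) p)]
  simp only [_root_.sub_apply]
  ring

theorem ver_eq_shift (i : Fin 2) : ver i = Deck.shift (0, Pi.single i 1) := by
  ext j
  · simp [ver, Deck.shift]
  · rcases eq_or_ne j i with rfl | h
    · simp [ver, Deck.shift]
    · simp [ver, Deck.shift, h]

theorem hor_eq_shift (i : Fin 2) : hor i = Deck.shift (Pi.single i 1, 0) := by
  ext j
  · rcases eq_or_ne j i with rfl | h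
    · simp [hor, Deck.shift]
    · simp [hor, Deck.shift, h]
  · simp [hor, Deck.shift]

end Averages

section TraceDifference

variable {K : KahlerT2Structure} {E : UTwoBundle}

/-- The fiber average of the difference of the trace forms of two connections on the same bundle:
a one-form on the base torus together with two functions, the fiber coefficients. -/
def traceDiff (Ξ Ξ' : UTwoConnection E) : Plane → Cover →L[ℝ] ℝ :=
  fiberAverage fun p => Ξ.traceForm p - Ξ'.traceForm p

variable (Ξ Ξ' : UTwoConnection E)

theorem contDiff_traceForm_sub : ContDiff ℝ ∞ fun p => Ξ.traceForm p - Ξ'.traceForm p :=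
  Ξ.contDiff_traceForm.sub Ξ'.contDiff_traceForm

theorem contDiff_traceDiff : ContDiff ℝ ∞ (traceDiff Ξ Ξ') :=
  contDiff_fiberAverage (contDiff_traceForm_sub Ξ Ξ')

theorem traceForm_sub_ver (i : Fin 2) (p : Cover) :
    Ξ.traceForm (p + ver i) - Ξ'.traceForm (p + ver i) = Ξ.traceForm p - Ξ'.traceForm p := by
  rw [ver_eq_shift]; exact Ξ.traceForm_sub_periodic Ξ' _ p

theorem traceDiff_periodic (i : Fin 2) (b : Plane) :
    traceDiff Ξ Ξ' (b + Pi.single i 1) = traceDiff Ξ Ξ' b := by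
  refine integral_congr_ae (ae_of_all _ fun t => ?_)
  have h := Ξ.traceForm_sub_periodic Ξ' (Pi.single i 1, 0) (b, t)
  rw [← hor_eq_shift] at h
  simpa [hor] using h

theorem fiberAverage_curl_sub (b : Plane) (u v : Cover) :
    fiberAverage (curl fun p => Ξ.traceForm p - Ξ'.traceForm p) b u v
      = fderiv ℝ (traceDiff Ξ Ξ') b u.1 v - fderiv ℝ (traceDiff Ξ Ξ') b v.1 u :=
  fiberAverage_curl (contDiff_traceForm_sub Ξ Ξ') (traceForm_sub_ver Ξ Ξ') b u v

theorem fderiv_traceDiff_apply (b w : Plane) (v : Cover) :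
    fderiv ℝ (fun b => traceDiff Ξ Ξ' b v) b w = fderiv ℝ (traceDiff Ξ Ξ') b w v :=
  fderiv_clm_apply_const ((contDiff_traceDiff Ξ Ξ').differentiable (by simp) b) w v

theorem contDiff_traceDiff_apply (v : Cover) : ContDiff ℝ ∞ fun b => traceDiff Ξ Ξ' b v :=
  (contDiff_traceDiff Ξ Ξ').clm_apply contDiff_const

variable {Ξ Ξ'}

/-- The fiber coefficients of the averaged difference of two Hermitian-Yang-Mills connections, for
possibly different parameters, are constant: their differential solves a linear elliptic system in
which the parameters do not occur. -/
theorem traceDiff_ver_eq {ε ε' : ℝ} (hε : ε ≠ 0) (hε' : ε' ≠ 0)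
    (h : IsHermitianYangMills K ε Ξ) (h' : IsHermitianYangMills K ε' Ξ') (j : Fin 2)
    (b b' : Plane) :
    traceDiff Ξ Ξ' b (ver j) = traceDiff Ξ Ξ' b' (ver j) := by
  obtain ⟨k, hk⟩ := h.exists_contraction hε
  obtain ⟨k', hk'⟩ := h'.exists_contraction hε'
  have hs := contDiff_traceForm_sub Ξ Ξ'
  have hc := continuous_curl hs
  have hcs := curl_sub Ξ.contDiff_traceForm Ξ'.contDiff_traceForm
  have hmix : ∀ b (w : Plane) (v : Cover), v.1 = 0 →
      fiberAverage (curl fun p => Ξ.traceForm p - Ξ'.traceForm p) b (w, 0) v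
        = fderiv ℝ (traceDiff Ξ Ξ') b w v := by
    intro b w v hv
    rw [fiberAverage_curl_sub, hv]; simp
  have hfib : ∀ b w (i : Fin 2), fderiv ℝ (traceDiff Ξ Ξ') b w (0, K.fiberJ b (Pi.single i 1))
      = fderiv ℝ (fun b => traceDiff Ξ Ξ' b (ver 0)) b w * K.fiberJMat 0 i b
        + fderiv ℝ (fun b => traceDiff Ξ Ξ' b (ver 1)) b w * K.fiberJMat 1 i b := by
    intro b w i
    rw [K.fiberJ_single, map_add, map_smul, map_smul, fderiv_traceDiff_apply,
      fderiv_traceDiff_apply, smul_eq_mul, smul_eq_mul]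
    ring
  have hS : ∀ b, fderiv ℝ (fun b => traceDiff Ξ Ξ' b (ver 0)) b (Pi.single 0 1) * K.fiberJMat 0 1 b
        + fderiv ℝ (fun b => traceDiff Ξ Ξ' b (ver 1)) b (Pi.single 0 1) * K.fiberJMat 1 1 b
      = fderiv ℝ (fun b => traceDiff Ξ Ξ' b (ver 0)) b (Pi.single 1 1) * K.fiberJMat 0 0 b
        + fderiv ℝ (fun b => traceDiff Ξ Ξ' b (ver 1)) b (Pi.single 1 1) * K.fiberJMat 1 0 b := by
    intro b
    rw [← hfib, ← hfib, ← hmix _ _ _ rfl, ← hmix _ _ _ rfl, ← sub_eq_zero, sub_eq_add_neg,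
      ← neg_one_mul]
    refine map_fiberAverage_eq_of_forall
      (evalPair (Pi.single 0 1, 0) (0, K.fiberJ b (Pi.single 1 1))
        + (-1 : ℝ) • evalPair (Pi.single 1 1, 0) (0, K.fiberJ b (Pi.single 0 1)))
      (f := curl fun p => Ξ.traceForm p - Ξ'.traceForm p) hc fun t => ?_
    simp only [_root_.add_apply, _root_.smul_apply, evalPair_apply, hcs, smul_eq_mul]
    rw [h.curl_mixed hε, h'.curl_mixed hε']
    ring
  have hD : ∀ b, K.pairing 0 0 b * fderiv ℝ (fun b => traceDiff Ξ Ξ' b (ver 1)) b (Pi.single 1 1)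
        - K.pairing 0 1 b * fderiv ℝ (fun b => traceDiff Ξ Ξ' b (ver 0)) b (Pi.single 1 1)
        - K.pairing 1 0 b * fderiv ℝ (fun b => traceDiff Ξ Ξ' b (ver 1)) b (Pi.single 0 1)
        + K.pairing 1 1 b * fderiv ℝ (fun b => traceDiff Ξ Ξ' b (ver 0)) b (Pi.single 0 1)
      = (k - k') * (K.pairing 0 0 b * K.pairing 1 1 b - K.pairing 0 1 b * K.pairing 1 0 b) := by
    intro b
    simp only [fderiv_traceDiff_apply]
    simp only [← hmix _ _ (ver 1) rfl, ← hmix _ _ (ver 0) rfl, sub_eq_add_neg, ← neg_mul]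
    refine map_fiberAverage_eq_of_forall
      (K.pairing 0 0 b • evalPair (hor 1) (ver 1) + (-K.pairing 0 1 b) • evalPair (hor 1) (ver 0)
        + (-K.pairing 1 0 b) • evalPair (hor 0) (ver 1)
        + K.pairing 1 1 b • evalPair (hor 0) (ver 0))
      (f := curl fun p => Ξ.traceForm p - Ξ'.traceForm p) hc fun t => ?_
    simp only [_root_.add_apply, _root_.smul_apply, evalPair_apply, hcs,
      smul_eq_mul]
    linear_combination hk b t - hk' b t
  have main := fderiv_eq_zero_of_primitive
    ⟨K.contDiff_pairing 0 0, K.contDiff_pairing 0 1, K.contDiff_pairing 1 0, K.contDiff_pairing 1 1⟩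
    ⟨K.continuous_fiberJMat 0 0, K.continuous_fiberJMat 0 1, K.continuous_fiberJMat 1 0,
      K.continuous_fiberJMat 1 1⟩
    (contDiff_traceDiff_apply Ξ Ξ' (ver 0)) (contDiff_traceDiff_apply Ξ Ξ' (ver 1))
    (fun i x => by simp only [K.pairing_periodic, and_self])
    (fun i x => by simp only [traceDiff_periodic, and_self])
    (Pi.single 0 1) (Pi.single 1 1)
    (fun x => ⟨K.pairing_closed 0 x, K.pairing_closed 1 x⟩) K.metric_symm
    (fun x => (K.metric_pos x).1) (fun x => (K.metric_pos x).2) hS hD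
  refine is_const_of_fderiv_eq_zero (f := fun b => traceDiff Ξ Ξ' b (ver j))
    ((contDiff_traceDiff_apply Ξ Ξ' (ver j)).differentiable (by simp)) (fun x => ?_) b b'
  refine ContinuousLinearMap.ext fun w => ?_
  have hw : w = w 0 • (Pi.single 0 1 : Plane) + w 1 • Pi.single 1 1 := by
    ext i; fin_cases i <;> simp
  obtain ⟨m1, m2, m3, m4⟩ := main x
  rw [hw, map_add, map_smul, map_smul]
  fin_cases j
  · simp [m1, m2]
  · simp [m3, m4]

/-- The degree of the bundle on the fibers, read off from the normal form of the determinant of its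
factor of automorphy, is the average of the curvature. -/
theorem fiberAverage_curl_ver (Ξ : UTwoConnection E) {φ : Cover → ℝ} {c : ℝ} (hφ : ContDiff ℝ ∞ φ)
    (h₀ : ∀ p, (E.e (0, Pi.single 0 1) p).det
      = Complex.exp (Complex.I * ((φ (p + ver 0) - φ p : ℝ) : ℂ)))
    (h₁ : ∀ p, (E.e (0, Pi.single 1 1) p).det
      = Complex.exp (Complex.I * ((φ (p + ver 1) - φ p - c * p.2 0 : ℝ) : ℂ))) (b : Plane) :
    fiberAverage (curl Ξ.traceForm) b (ver 0) (ver 1) = -c := by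
  set ℓ : Fin 2 → Cover →L[ℝ] ℝ := fun i => .proj i ∘L .snd ℝ Plane Plane with hℓ
  have hℓv : ∀ i j, ℓ i (ver j) = if i = j then 1 else 0 := fun i j => by
    simp [hℓ, ver, Pi.single_apply]
  have hφ' : ContDiff ℝ ∞ (fderiv ℝ φ) := hφ.fderiv_right (by simp)
  have hτ : ∀ v : Cover, ContDiff ℝ ∞ fun p => φ (p + v) := fun v =>
    hφ.comp (contDiff_id.add contDiff_const)
  have hdτ : ∀ v p : Cover, HasFDerivAt (fun p => φ (p + v) - φ p)
      (fderiv ℝ φ (p + v) - fderiv ℝ φ p) p := fun v p => by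
    have h1 := ((hτ v).differentiable (by simp) p).hasFDerivAt
    rw [fderiv_comp_add_right] at h1
    exact h1.sub (hφ.differentiable (by simp) p).hasFDerivAt
  have s₀ : ∀ p, Ξ.traceForm (p + ver 0)
      = Ξ.traceForm p - (fderiv ℝ φ (p + ver 0) - fderiv ℝ φ p) := fun p => by
    have := Ξ.traceForm_shift (0, Pi.single 0 1) (θ := fun p => φ (p + ver 0) - φ p)
      ((hτ _).sub hφ) h₀ p
    rwa [← ver_eq_shift, (hdτ _ p).fderiv] at this
  have s₁ : ∀ p, Ξ.traceForm (p + ver 1)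
      = Ξ.traceForm p - (fderiv ℝ φ (p + ver 1) - fderiv ℝ φ p - c • ℓ 0) := fun p => by
    have := Ξ.traceForm_shift (0, Pi.single 1 1) (θ := fun p => φ (p + ver 1) - φ p - c * ℓ 0 p)
      (((hτ _).sub hφ).sub (contDiff_const.mul (ℓ 0).contDiff)) h₁ p
    rwa [← ver_eq_shift, ((hdτ _ p).fun_sub ((ℓ 0).hasFDerivAt.const_mul c)).fderiv] at this
  -- subtracting `c x₂ dx₁` makes the form periodic
  set κ : Cover → Cover →L[ℝ] ℝ := fun p => Ξ.traceForm p + fderiv ℝ φ p - (c * ℓ 1 p) • ℓ 0 with hκ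
  have hκs : ContDiff ℝ ∞ κ := (Ξ.contDiff_traceForm.add hφ').sub
    ((contDiff_const.mul (ℓ 1).contDiff).smul contDiff_const)
  have hκp : ∀ (i : Fin 2) (p : Cover), κ (p + ver i) = κ p := by
    intro i p
    fin_cases i
    · simp only [hκ, Fin.zero_eta, s₀, map_add, hℓv]
      simp only [one_ne_zero, if_false, add_zero]
      abel
    · simp only [hκ, Fin.mk_one, s₁, map_add, hℓv]
      simp only [if_true, mul_add, mul_one, add_smul]
      abel
  have hκc : ∀ p, curl κ p (ver 0) (ver 1) = curl Ξ.traceForm p (ver 0) (ver 1) + c := by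
    intro p
    have hd : HasFDerivAt κ (fderiv ℝ Ξ.traceForm p + fderiv ℝ (fderiv ℝ φ) p
        - (c • ℓ 1).smulRight (ℓ 0)) p :=
      ((Ξ.contDiff_traceForm.differentiable (by simp) p).hasFDerivAt.add
        (hφ'.differentiable (by simp) p).hasFDerivAt).sub
        (((ℓ 1).hasFDerivAt.const_mul c).smul_const (ℓ 0))
    have hsymm := (hφ.contDiffAt (x := p)).isSymmSndFDerivAt (by
        rw [minSmoothness_of_isRCLikeNormedField]
        exact WithTop.coe_le_coe.2 (le_top (a := (2 : ℕ∞)))) (ver 0) (ver 1)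
    rw [curl_apply, curl_apply, hd.fderiv]
    simp only [_root_.sub_apply, _root_.add_apply, ContinuousLinearMap.smulRight_apply,
      _root_.smul_apply, smul_eq_mul, hℓv, hsymm]
    simp
    ring
  have h1 := fiberAverage_curl hκs hκp b (ver 0) (ver 1)
  have h2 : evalPair (ver 0) (ver 1) (fiberAverage (curl κ) b)
      = evalPair (ver 0) (ver 1) (fiberAverage (curl Ξ.traceForm) b) + c := by
    rw [map_fiberAverage _ (f := curl κ) (continuous_curl hκs),
      map_fiberAverage _ (f := curl Ξ.traceForm) (continuous_curl Ξ.contDiff_traceForm)]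
    simp only [evalPair_apply, hκc]
    have h3 : Continuous fun p => curl Ξ.traceForm p (ver 0) (ver 1) :=
      (evalPair (ver 0) (ver 1)).continuous.comp (continuous_curl Ξ.contDiff_traceForm)
    rw [fiberAverage_add h3 continuous_const, fiberAverage_const]
  rw [evalPair_apply, evalPair_apply, h1] at h2
  simp [ver] at h2
  simp only [ver]
  linarith

/-- The determinant of `N(b)`. -/
def KahlerT2Structure.fiberJDet (K : KahlerT2Structure) (b : Plane) : ℝ :=
  K.fiberJMat 0 0 b * K.fiberJMat 1 1 b - K.fiberJMat 0 1 b * K.fiberJMat 1 0 b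

theorem fiberAverage_curl_hor {ε : ℝ} (h : IsHermitianYangMills K ε Ξ) (b : Plane) :
    fiberAverage (curl Ξ.traceForm) b (hor 0) (hor 1)
      = (ε⁻¹) ^ 2 * K.fiberJDet b * fiberAverage (curl Ξ.traceForm) b (ver 0) (ver 1) := by
  have h0 : ∀ t, (evalPair (hor 0) (hor 1)
      + (-((ε⁻¹) ^ 2 * K.fiberJDet b)) • evalPair (ver 0) (ver 1)) (curl Ξ.traceForm (b, t))
      = 0 := by
    intro t
    have h1 := h.curl_base b t (Pi.single 0 1) (Pi.single 1 1)
    have hz : ∀ u, curl Ξ.traceForm (b, t) u u = 0 := fun u => by rw [curl_apply, sub_self]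
    rw [K.fiberJ_single, K.fiberJ_single] at h1
    simp only [map_add, map_smul, _root_.add_apply, _root_.smul_apply, smul_eq_mul, hz] at h1
    rw [curl_swap _ _ (ver 1) (ver 0)] at h1
    simp only [_root_.add_apply, _root_.smul_apply, evalPair_apply, smul_eq_mul,
      KahlerT2Structure.fiberJDet]
    rw [show hor 0 = (Pi.single 0 1, 0) from rfl, show hor 1 = (Pi.single 1 1, 0) from rfl, h1]
    ring
  have h2 := map_fiberAverage_eq_of_forall _ (f := curl Ξ.traceForm)
    (continuous_curl Ξ.contDiff_traceForm) h0
  simp only [_root_.add_apply, _root_.smul_apply, evalPair_apply, smul_eq_mul] at h2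
  linarith

theorem fderiv_traceDiff_hor_sub {ε ε' c : ℝ} (h : IsHermitianYangMills K ε Ξ)
    (h' : IsHermitianYangMills K ε' Ξ')
    (hc : ∀ (Ξ : UTwoConnection E) b, fiberAverage (curl Ξ.traceForm) b (ver 0) (ver 1) = -c)
    (b : Plane) :
    fderiv ℝ (traceDiff Ξ Ξ') b (Pi.single 0 1) (hor 1)
      - fderiv ℝ (traceDiff Ξ Ξ') b (Pi.single 1 1) (hor 0)
      = ((ε'⁻¹) ^ 2 - (ε⁻¹) ^ 2) * c * K.fiberJDet b := by
  have h1 := fiberAverage_curl_sub Ξ Ξ' b (hor 0) (hor 1)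
  have h2 : evalPair (hor 0) (hor 1)
      (fiberAverage (curl fun p => Ξ.traceForm p - Ξ'.traceForm p) b)
      = evalPair (hor 0) (hor 1) (fiberAverage (curl Ξ.traceForm) b)
        - evalPair (hor 0) (hor 1) (fiberAverage (curl Ξ'.traceForm) b) := by
    rw [map_fiberAverage _ (f := curl fun p => Ξ.traceForm p - Ξ'.traceForm p)
        (continuous_curl (contDiff_traceForm_sub Ξ Ξ')),
      map_fiberAverage _ (f := curl Ξ.traceForm) (continuous_curl Ξ.contDiff_traceForm),
      map_fiberAverage _ (f := curl Ξ'.traceForm) (continuous_curl Ξ'.contDiff_traceForm)]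
    simp only [evalPair_apply, curl_sub Ξ.contDiff_traceForm Ξ'.contDiff_traceForm]
    have h3 : ∀ Ξ : UTwoConnection E, Continuous fun p => curl Ξ.traceForm p (hor 0) (hor 1) :=
      fun Ξ => (evalPair (hor 0) (hor 1)).continuous.comp (continuous_curl Ξ.contDiff_traceForm)
    exact integral_sub (integrableOn_fiber (h3 Ξ) b) (integrableOn_fiber (h3 Ξ') b)
  rw [evalPair_apply, evalPair_apply, evalPair_apply, h1, fiberAverage_curl_hor h,
    fiberAverage_curl_hor h', hc, hc] at h2
  simp only [hor] at h2 ⊢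
  rw [h2]; ring

/-- A bundle carrying Hermitian-Yang-Mills connections for two different parameters has degree
zero on the fibers. -/
theorem degree_eq_zero {ε ε' c : ℝ} (hε : 0 < ε) (hε' : 0 < ε') (hne : ε ≠ ε')
    (h : IsHermitianYangMills K ε Ξ) (h' : IsHermitianYangMills K ε' Ξ')
    (hc : ∀ (Ξ : UTwoConnection E) b, fiberAverage (curl Ξ.traceForm) b (ver 0) (ver 1) = -c) :
    c = 0 := by
  have h1 := setIntegral_divergence_eq_zero
    (u₀ := fun b => traceDiff Ξ Ξ' b (hor 1)) (u₁ := fun b => -traceDiff Ξ Ξ' b (hor 0))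
    ((contDiff_traceDiff_apply Ξ Ξ' _).of_le (by simp))
    ((contDiff_traceDiff_apply Ξ Ξ' _).neg.of_le (by simp))
    (fun i x => by simp only [traceDiff_periodic]) (fun i x => by simp only [traceDiff_periodic])
    (Pi.single 0 1) (Pi.single 1 1)
  have h2 : ∀ b, fderiv ℝ (fun b => traceDiff Ξ Ξ' b (hor 1)) b (Pi.single 0 1)
      + fderiv ℝ (fun b => -traceDiff Ξ Ξ' b (hor 0)) b (Pi.single 1 1)
      = ((ε'⁻¹) ^ 2 - (ε⁻¹) ^ 2) * c * K.fiberJDet b := fun b => by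
    rw [← fderiv_traceDiff_hor_sub h h' hc, fderiv_fun_neg, _root_.neg_apply,
      fderiv_traceDiff_apply, fderiv_traceDiff_apply, sub_eq_add_neg]
  simp only [h2, integral_const_mul] at h1
  have hdet : ∀ b, K.fiberJDet b ≠ 0 := fun b h0 => by
    have := (K.metric_pos b).2
    rw [KahlerT2Structure.fiberJDet] at h0
    rw [h0, mul_zero] at this
    exact lt_irrefl _ this
  have h3 : ∫ x in Set.Icc (0 : Plane) 1, K.fiberJDet x ≠ 0 :=
    setIntegral_ne_zero_of_periodic
      (((K.continuous_fiberJMat 0 0).mul (K.continuous_fiberJMat 1 1)).sub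
        ((K.continuous_fiberJMat 0 1).mul (K.continuous_fiberJMat 1 0))) hdet
      fun i x => by simp only [KahlerT2Structure.fiberJDet, K.fiberJMat_periodic]
  have h4 := (mul_eq_zero.1 h1).resolve_right h3
  refine (mul_eq_zero.1 h4).resolve_left fun h5 => hne ?_
  have h6 : (ε'⁻¹) ^ 2 = (ε⁻¹) ^ 2 := by linarith
  have h7 := (pow_left_inj₀ (inv_nonneg.2 hε'.le) (inv_nonneg.2 hε.le) two_ne_zero).1 h6
  exact (inv_inj.1 h7).symm

/-- In fiber degree zero the base part of the averaged difference of two Hermitian-Yang-Mills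
connections is closed. -/
theorem fderiv_traceDiff_hor_symm {ε ε' : ℝ} (h : IsHermitianYangMills K ε Ξ)
    (h' : IsHermitianYangMills K ε' Ξ')
    (hc : ∀ (Ξ : UTwoConnection E) b, fiberAverage (curl Ξ.traceForm) b (ver 0) (ver 1) = 0)
    (b w w' : Plane) :
    fderiv ℝ (traceDiff Ξ Ξ') b w (w', 0) = fderiv ℝ (traceDiff Ξ Ξ') b w' (w, 0) := by
  have h1 := fderiv_traceDiff_hor_sub (c := 0) h h' (fun Ξ b => by rw [hc, neg_zero]) b
  rw [mul_zero, zero_mul, sub_eq_zero] at h1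
  have hw : ∀ w : Plane, w = w 0 • (Pi.single 0 1 : Plane) + w 1 • Pi.single 1 1 := fun w => by
    ext i; fin_cases i <;> simp
  rw [horizontal_eq w, horizontal_eq w']
  nth_rewrite 1 [hw w]
  nth_rewrite 3 [hw w']
  simp only [map_add, map_smul, _root_.add_apply, _root_.smul_apply, smul_eq_mul, h1]
  ring

end TraceDifference

/-! ### Trivializing the bundle near a fiber -/

/-- The translation of the universal cover by a lattice vector of the fiber. -/
abbrev fiberShift (n : Fin 2 → ℤ) : Cover := Deck.shift (0, n)

theorem fiberShift_apply (n : Fin 2 → ℤ) (b x : Plane) :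
    ((b, x) : Cover) + fiberShift n = (b, x + fun i => (n i : ℝ)) := by
  ext i <;> simp [Deck.shift]

theorem shift_add (γ δ : Deck) : Deck.shift (γ + δ) = Deck.shift γ + Deck.shift δ := by
  ext i <;> simp [Deck.shift]

theorem shift_neg (γ : Deck) : Deck.shift (-γ) = -Deck.shift γ := by
  ext i <;> simp [Deck.shift]

theorem shift_zero : Deck.shift 0 = 0 := by
  ext i <;> simp [Deck.shift]

theorem UTwoBundle.e_zero (E : UTwoBundle) (p : Cover) : E.e 0 p = 1 := by
  have h := E.e_add 0 0 p
  rw [add_zero, shift_zero, add_zero] at h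
  have hu := (Matrix.mem_unitaryGroup_iff (A := E.e 0 p)).1 (E.e_unitary 0 p)
  calc E.e 0 p = E.e 0 p * E.e 0 p * star (E.e 0 p) := by rw [mul_assoc, hu, mul_one]
    _ = 1 := by rw [← h, hu]

theorem UTwoBundle.e_mulVec_eq_zero (E : UTwoBundle) (γ : Deck) (p : Cover) {v : Fin 2 → ℂ}
    (h : E.e γ p *ᵥ v = 0) : v = 0 := by
  have hu := (Matrix.mem_unitaryGroup_iff' (A := E.e γ p)).1 (E.e_unitary γ p)
  rw [← one_mulVec v, ← hu, ← mulVec_mulVec, h, mulVec_zero]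

section Bump

/-- A smooth function which is positive on `(1/8, 7/8)` and zero elsewhere. -/
def cellBump (t : ℝ) : ℝ := expNegInvGlue (t - 1 / 8) * expNegInvGlue (7 / 8 - t)

theorem contDiff_cellBump : ContDiff ℝ ∞ cellBump :=
  (expNegInvGlue.contDiff.comp (contDiff_id.sub contDiff_const)).mul
    (expNegInvGlue.contDiff.comp (contDiff_const.sub contDiff_id))

theorem cellBump_pos {t : ℝ} (h : t ∈ Set.Ioo (1 / 8 : ℝ) (7 / 8)) : 0 < cellBump t :=
  mul_pos (expNegInvGlue.pos_of_pos (by linarith [h.1]))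
    (expNegInvGlue.pos_of_pos (by linarith [h.2]))

theorem cellBump_eq_zero {t : ℝ} (h : t ∉ Set.Ioo (1 / 8 : ℝ) (7 / 8)) : cellBump t = 0 := by
  rw [Set.mem_Ioo, not_and_or, not_lt, not_lt] at h
  rcases h with h | h
  · rw [cellBump, expNegInvGlue.zero_of_nonpos (by linarith), zero_mul]
  · rw [cellBump, expNegInvGlue.zero_of_nonpos (x := 7 / 8 - t) (by linarith), mul_zero]

variable (a : Plane)

/-- The lattice vector translating the unit cell at `a` to the one containing `x`. -/
def cellIndex (x : Plane) (i : Fin 2) : ℤ := ⌊x i - a i⌋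

/-- The periodic function with one bump in the interior of every unit cell with corner `a`. -/
def cellWeight (x : Plane) : ℝ := ∏ i, cellBump (Int.fract (x i - a i))

/-- The equivariant matrix function which is a multiple of the canonical frame over the unit cell at
`a`, cut off near the boundary of the cell. -/
def cellFrame (E : UTwoBundle) (p : Cover) : Mat :=
  cellWeight a p.2 •
    E.e (0, cellIndex a p.2) (p + fiberShift (-cellIndex a p.2))

theorem cellIndex_add (x : Plane) (n : Fin 2 → ℤ) :
    cellIndex a (x + fun i => (n i : ℝ)) = cellIndex a x + n := by
  ext i
  simp only [cellIndex, Pi.add_apply, add_sub_right_comm, Int.floor_add_intCast]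

theorem cellWeight_add (x : Plane) (n : Fin 2 → ℤ) :
    cellWeight a (x + fun i => (n i : ℝ)) = cellWeight a x := by
  simp only [cellWeight, Pi.add_apply, add_sub_right_comm, Int.fract_add_intCast]

theorem cellFrame_equivariant (E : UTwoBundle) (n : Fin 2 → ℤ) (p : Cover) :
    cellFrame a E (p + fiberShift n) = E.e (0, n) p * cellFrame a E p := by
  obtain ⟨b, x⟩ := p
  have h1 : ((b, x) : Cover) + fiberShift n + fiberShift (-(cellIndex a x + n))
      = (b, x) + fiberShift (-cellIndex a x) := by
    rw [add_assoc, ← shift_add]; congr 3; ext i <;> simp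
  have h2 : ((b, x) : Cover) + fiberShift (-cellIndex a x) + fiberShift (cellIndex a x)
      = (b, x) := by
    rw [add_assoc, ← shift_add]
    have : ((0, -cellIndex a x) + (0, cellIndex a x) : Deck) = 0 := by ext i <;> simp
    rw [this, shift_zero, add_zero]
  have h3 := E.e_add (0, n) (0, cellIndex a x) ((b, x) + fiberShift (-cellIndex a x))
  rw [h2] at h3
  have h4 : ((0, n) + (0, cellIndex a x) : Deck) = (0, cellIndex a x + n) := by
    ext i <;> simp [add_comm]
  rw [h4] at h3
  have e1 : (((b, x) : Cover) + fiberShift n).2 = x + fun i => (n i : ℝ) := by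
    rw [fiberShift_apply]
  rw [cellFrame, e1, cellIndex_add, cellWeight_add, h1, h3, cellFrame, mul_smul_comm]

theorem contDiff_cellFrame (E : UTwoBundle) : ContDiff ℝ ∞ (cellFrame a E) := by
  rw [contDiff_iff_contDiffAt]
  intro p
  have hcoord : ∀ i, Continuous fun q : Cover => q.2 i - a i := fun i =>
    ((continuous_apply i).comp continuous_snd).sub continuous_const
  by_cases hint : ∃ i, Int.fract (p.2 i - a i) = 0
  · -- near the boundary of the cell the weight vanishes
    obtain ⟨i, hi⟩ := hint
    have hm : p.2 i - a i = (⌊p.2 i - a i⌋ : ℝ) := by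
      have := Int.floor_add_fract (p.2 i - a i)
      rw [hi, add_zero] at this; exact this.symm
    set m : ℤ := ⌊p.2 i - a i⌋ with hm'
    have hloc : cellFrame a E =ᶠ[𝓝 p] fun _ => 0 := by
      have hev : ∀ᶠ q in 𝓝 p, q.2 i - a i ∈ Set.Ioo ((m : ℝ) - 1 / 8) (m + 1 / 8) :=
        (hcoord i).continuousAt.eventually_mem (by
          rw [hm]; exact Ioo_mem_nhds (by linarith) (by linarith))
      filter_upwards [hev] with q hq
      have hz : cellWeight a q.2 = 0 := by
        refine Finset.prod_eq_zero (Finset.mem_univ i) (cellBump_eq_zero fun hmem => ?_)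
        set t := q.2 i - a i
        have hfl := Int.floor_add_fract t
        have hle : (⌊t⌋ : ℝ) ≤ t := Int.floor_le t
        rcases le_or_gt (m : ℝ) t with hmt | hmt
        · have : ⌊t⌋ = m := Int.floor_eq_iff.2 ⟨hmt, by linarith [hq.2]⟩
          rw [this] at hfl
          linarith [hmem.1, hq.2]
        · have : ⌊t⌋ = m - 1 := Int.floor_eq_iff.2 ⟨by push_cast; linarith [hq.1],
            by push_cast; linarith⟩
          rw [this] at hfl
          push_cast at hfl
          linarith [hmem.2, hq.1]
      rw [cellFrame, hz, zero_smul]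
    exact contDiffAt_const.congr_of_eventuallyEq hloc
  · push Not at hint
    set k := cellIndex a p.2 with hk
    have hloc : cellFrame a E =ᶠ[𝓝 p] fun q => (∏ i, cellBump (q.2 i - a i - k i)) •
        E.e (0, k) (q + fiberShift (-k)) := by
      have hev : ∀ i, ∀ᶠ q in 𝓝 p, ⌊q.2 i - a i⌋ = k i := by
        intro i
        have hlt : (k i : ℝ) < p.2 i - a i := by
          have h1 := Int.floor_add_fract (p.2 i - a i)
          have h2 := lt_of_le_of_ne (Int.fract_nonneg (p.2 i - a i)) (hint i).symm
          simp only [hk, cellIndex]; linarith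
        have hlt2 : p.2 i - a i < k i + 1 := Int.lt_floor_add_one _
        filter_upwards [(hcoord i).continuousAt.eventually_mem (Ioo_mem_nhds hlt hlt2)] with q hq
        exact Int.floor_eq_iff.2 ⟨hq.1.le, hq.2⟩
      filter_upwards [hev 0, hev 1] with q h0 h1
      have hkq : cellIndex a q.2 = k := by
        ext i; fin_cases i
        · exact h0
        · exact h1
      have hw : cellWeight a q.2 = ∏ i, cellBump (q.2 i - a i - k i) := by
        refine Finset.prod_congr rfl fun i _ => ?_
        rw [← hkq]; rfl
      rw [cellFrame, hkq, hw]
    refine ContDiffAt.congr_of_eventuallyEq (ContDiff.contDiffAt ?_) hloc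
    have h1 : ContDiff ℝ ∞ fun q : Cover => ∏ i, cellBump (q.2 i - a i - k i) :=
      contDiff_prod fun i _ => contDiff_cellBump.comp
        ((((contDiff_apply ℝ ℝ i).comp contDiff_snd).sub contDiff_const).sub contDiff_const)
    have h2 : ContDiff ℝ ∞ fun q : Cover => E.e (0, k) (q + fiberShift (-k)) :=
      (E.e_smooth _).comp (contDiff_id.add contDiff_const)
    exact h1.smul h2

end Bump

/-- A smooth section of the bundle, invariant under the deck transformations of the fiber. -/
structure IsFiberSection (E : UTwoBundle) (σ : Cover → Fin 2 → ℂ) : Prop where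
  smooth : ContDiff ℝ ∞ σ
  equivariant : ∀ (n : Fin 2 → ℤ) (p : Cover), σ (p + fiberShift n) = E.e (0, n) p *ᵥ σ p

theorem contDiff_mulVec_const {m : Cover → Mat} (hm : ContDiff ℝ ∞ m) (v : Fin 2 → ℂ) :
    ContDiff ℝ ∞ fun p => m p *ᵥ v := by
  rw [contDiff_pi]
  intro i
  have h : ∀ i j, ContDiff ℝ ∞ fun p => m p i j := fun i j =>
    (Matrix.entryLinearMap ℝ ℂ i j).toContinuousLinearMap.contDiff.comp hm
  change ContDiff ℝ ∞ fun p => ∑ j, m p i j * v j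
  exact ContDiff.sum fun j _ => (h i j).mul contDiff_const

/-- General position: the fiber is a surface and `ℂ²` has real dimension four, so a section can be
made nonzero over the interior of a cell of the fiber above `b`, without destroying that
it is nonzero elsewhere. -/
theorem IsFiberSection.exists_perturbation {E : UTwoBundle} {σ : Cover → Fin 2 → ℂ}
    (hσ : IsFiberSection E σ) (b a : Plane) :
    ∃ τ, IsFiberSection E τ ∧ ∀ x : Plane,
      (σ (b, x) ≠ 0 ∨ ∀ i, Int.fract (x i - a i) ∈ Set.Ioo (1 / 8 : ℝ) (7 / 8)) → τ (b, x) ≠ 0 := by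
  set B : Set Plane := Set.pi Set.univ fun i => Set.Ioo (a i + 1 / 8) (a i + 7 / 8) with hB
  have hBc : Convex ℝ B := convex_pi fun i _ => convex_Ioo _ _
  have hfr : ∀ y ∈ B, ∀ i, ⌊y i - a i⌋ = 0 := fun y hy i => by
    have := hy i trivial
    exact Int.floor_eq_iff.2 ⟨by push_cast; linarith [this.1], by push_cast; linarith [this.2]⟩
  have hTB : ∀ y ∈ B, cellFrame a E (b, y) = (∏ i, cellBump (y i - a i)) • (1 : Mat) := by
    intro y hy
    have hk : cellIndex a y = 0 := by ext i; exact hfr y hy i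
    have hw : cellWeight a y = ∏ i, cellBump (y i - a i) := by
      refine Finset.prod_congr rfl fun i _ => ?_
      rw [Int.fract, hfr y hy i]; simp
    have h0 : E.e (0, 0) ((b, y) + fiberShift (-0)) = 1 := E.e_zero _
    simp only [cellFrame, hk, hw, h0]
  have hpos : ∀ y ∈ B, 0 < ∏ i, cellBump (y i - a i) := fun y hy =>
    Finset.prod_pos fun i _ => cellBump_pos ⟨by linarith [(hy i trivial).1],
      by linarith [(hy i trivial).2]⟩
  set g : Plane → Fin 2 → ℂ := fun y => -((∏ i, cellBump (y i - a i))⁻¹ • σ (b, y)) with hg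
  have hgs : ContDiffOn ℝ 1 g B := by
    refine ContDiffOn.neg (ContDiffOn.smul (ContDiffOn.inv ?_ fun y hy => (hpos y hy).ne') ?_)
    · refine ContDiff.contDiffOn (ContDiff.of_le (contDiff_prod fun i _ =>
        contDiff_cellBump.comp ?_) (by simp))
      exact (contDiff_apply ℝ ℝ i).sub contDiff_const
    · exact ((hσ.smooth.comp (contDiff_const.prodMk contDiff_id)).of_le (by simp)).contDiffOn
  have hdim : dimH B < Module.finrank ℝ (Fin 2 → ℂ) := by
    refine (dimH_mono (Set.subset_univ B)).trans_lt ?_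
    rw [Real.dimH_univ_eq_finrank]
    have h1 : Module.finrank ℝ Plane = 2 := by simp
    have h2 : Module.finrank ℝ (Fin 2 → ℂ) = 4 := by
      rw [Module.finrank_pi_fintype]; simp
    rw [h1, h2]; norm_num
  obtain ⟨v, hv⟩ := (hgs.dense_compl_image_of_dimH_lt_finrank hBc subset_rfl hdim).nonempty
  refine ⟨fun p => σ p + cellFrame a E p *ᵥ v, ⟨hσ.smooth.add
    (contDiff_mulVec_const (contDiff_cellFrame a E) v), fun n p => ?_⟩, fun x hx => ?_⟩
  · rw [hσ.equivariant, cellFrame_equivariant, mulVec_add, mulVec_mulVec]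
  by_cases hgood : ∀ i, Int.fract (x i - a i) ∈ Set.Ioo (1 / 8 : ℝ) (7 / 8)
  · set k := cellIndex a x with hk
    set y : Plane := x + fun i => ((-k) i : ℝ) with hy
    have hyB : y ∈ B := fun i _ => by
      have h1 := hgood i
      have h2 : y i = a i + Int.fract (x i - a i) := by
        simp only [hy, hk, Pi.add_apply, Pi.neg_apply, cellIndex, Int.fract]; push_cast; ring
      rw [h2]
      exact ⟨by linarith [h1.1], by linarith [h1.2]⟩
    have hxy : ((b, x) : Cover) = (b, y) + fiberShift k := by
      rw [fiberShift_apply]; congr 1; ext i; simp [hy]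
    intro h0
    simp only [hxy] at h0
    rw [hσ.equivariant, cellFrame_equivariant, ← mulVec_mulVec, ← mulVec_add] at h0
    have h1 := E.e_mulVec_eq_zero _ _ h0
    rw [hTB y hyB, smul_mulVec, one_mulVec] at h1
    refine hv ⟨y, hyB, ?_⟩
    simp only [hg]
    rw [eq_neg_of_add_eq_zero_left h1, smul_neg, neg_neg, smul_smul,
      inv_mul_cancel₀ (hpos y hyB).ne', one_smul]
  · have hx' := hx.resolve_right hgood
    push Not at hgood
    obtain ⟨i, hi⟩ := hgood
    have hz : cellFrame a E (b, x) = 0 := by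
      rw [cellFrame, cellWeight, Finset.prod_eq_zero (Finset.mem_univ i) (cellBump_eq_zero hi),
        zero_smul]
    simpa [hz] using hx'

/-- Every rank two bundle has a section without zeros on a given fiber. -/
theorem exists_fiberSection_ne_zero (E : UTwoBundle) (b : Plane) :
    ∃ σ, IsFiberSection E σ ∧ ∀ x, σ (b, x) ≠ 0 := by
  have hlist : ∀ l : List Plane, ∃ σ, IsFiberSection E σ ∧ ∀ x : Plane,
      (∃ a ∈ l, ∀ i, Int.fract (x i - a i) ∈ Set.Ioo (1 / 8 : ℝ) (7 / 8)) → σ (b, x) ≠ 0 := by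
    intro l
    induction l with
    | nil => exact ⟨fun _ => 0, ⟨contDiff_const, fun n p => (mulVec_zero _).symm⟩, by simp⟩
    | cons a l ih =>
      obtain ⟨σ, hσ, hne⟩ := ih
      obtain ⟨τ, hτ, hτne⟩ := hσ.exists_perturbation b a
      refine ⟨τ, hτ, fun x hx => hτne x ?_⟩
      obtain ⟨a', ha', h⟩ := hx
      rcases List.mem_cons.1 ha' with rfl | ha'
      · exact Or.inr h
      · exact Or.inl (hne x ⟨a', ha', h⟩)
  -- the cells with corners `0` or `1/2` in each coordinate, shrunk by `1/8`, cover the fiber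
  obtain ⟨σ, hσ, hne⟩ := hlist [![0, 0], ![0, 1 / 2], ![1 / 2, 0], ![1 / 2, 1 / 2]]
  refine ⟨σ, hσ, fun x => hne x ?_⟩
  have hone : ∀ t : ℝ, Int.fract (t - 0) ∈ Set.Ioo (1 / 8 : ℝ) (7 / 8) ∨
      Int.fract (t - 1 / 2) ∈ Set.Ioo (1 / 8 : ℝ) (7 / 8) := by
    intro t
    have h0 := Int.fract_nonneg t
    have h1 := Int.fract_lt_one t
    have h2 := Int.floor_add_fract t
    rw [sub_zero]
    by_cases ht : Int.fract t ∈ Set.Ioo (1 / 8 : ℝ) (7 / 8)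
    · exact Or.inl ht
    · right
      rw [Set.mem_Ioo, not_and_or, not_lt, not_lt] at ht
      rcases ht with ht | ht
      · have : Int.fract (t - 1 / 2) = Int.fract t + 1 / 2 :=
          Int.fract_eq_iff.2 ⟨by linarith, by linarith, ⌊t⌋ - 1, by push_cast; linarith⟩
        rw [this]; constructor <;> linarith
      · have : Int.fract (t - 1 / 2) = Int.fract t - 1 / 2 :=
          Int.fract_eq_iff.2 ⟨by linarith, by linarith, ⌊t⌋, by linarith⟩
        rw [this]; constructor <;> linarith
  rcases hone (x 0) with h0 | h0 <;> rcases hone (x 1) with h1 | h1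
  · exact ⟨![0, 0], by simp, fun i => by fin_cases i <;> assumption⟩
  · exact ⟨![0, 1 / 2], by simp, fun i => by fin_cases i <;> assumption⟩
  · exact ⟨![1 / 2, 0], by simp, fun i => by fin_cases i <;> assumption⟩
  · exact ⟨![1 / 2, 1 / 2], by simp, fun i => by fin_cases i <;> assumption⟩

theorem contDiffOn_matrix {f : Cover → Mat} {U : Set Cover}
    (h : ∀ i j, ContDiffOn ℝ ∞ (fun p => f p i j) U) : ContDiffOn ℝ ∞ f U := by
  have h1 : ContDiffOn ℝ ∞ (fun p => (fun i j => f p i j : Fin 2 → Fin 2 → ℂ)) U :=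
    contDiffOn_pi.2 fun i => contDiffOn_pi.2 fun j => h i j
  exact (LinearMap.toContinuousLinearMap
    (Matrix.ofLinearEquiv ℝ (m := Fin 2) (n := Fin 2) (α := ℂ)).toLinearMap).contDiff.comp_contDiffOn
      h1

/-- The properties of lattice vectors which hold for the generators and are closed under the group
operations hold for all lattice vectors. -/
theorem lattice_induction {P : (Fin 2 → ℤ) → Prop} (h0 : P 0)
    (hadd : ∀ n m, P n → P m → P (n + m)) (hneg : ∀ n, P n → P (-n))
    (hgen : ∀ i, P (Pi.single i 1)) (n : Fin 2 → ℤ) : P n := by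
  have hz : ∀ i (m : ℤ), P (m • Pi.single i 1) := by
    intro i m
    induction m using Int.induction_on with
    | zero => simpa using h0
    | succ m ih => rw [add_smul, one_smul]; exact hadd _ _ ih (hgen i)
    | pred m ih => rw [sub_smul, one_smul, sub_eq_add_neg]; exact hadd _ _ ih (hneg _ (hgen i))
  have hn : n = n 0 • Pi.single 0 1 + n 1 • Pi.single 1 1 := by
    ext i; fin_cases i <;> simp
  rw [hn]; exact hadd _ _ (hz 0 _) (hz 1 _)

theorem UTwoBundle.det_fiber_eq (E : UTwoBundle) {φ : Cover → ℝ}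
    (hdet : ∀ i p, (E.e (0, Pi.single i 1) p).det
      = Complex.exp (Complex.I * ((φ (p + ver i) - φ p : ℝ) : ℂ))) (n : Fin 2 → ℤ) (p : Cover) :
    (E.e (0, n) p).det = Complex.exp (Complex.I * ((φ (p + fiberShift n) - φ p : ℝ) : ℂ)) := by
  revert p
  have hz : ∀ p, E.e (0, 0) p = 1 := E.e_zero
  refine lattice_induction (P := fun n => ∀ p, (E.e (0, n) p).det
    = Complex.exp (Complex.I * ((φ (p + fiberShift n) - φ p : ℝ) : ℂ))) ?_ ?_ ?_ ?_ n
  · intro p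
    have : fiberShift 0 = 0 := shift_zero
    rw [hz, this]; simp
  · intro n m hn hm p
    have h := E.e_add (0, n) (0, m) p
    have h2 : ((0, n) + (0, m) : Deck) = (0, n + m) := by simp
    rw [h2] at h
    have h3 : fiberShift (n + m) = fiberShift m + fiberShift n := by
      have : ((0, m) + (0, n) : Deck) = (0, n + m) := by rw [add_comm n m]; simp
      rw [← shift_add, this]
    rw [h, det_mul, hn, hm, ← Complex.exp_add, h3, ← add_assoc]
    congr 1; push_cast; ring
  · intro n hn p
    have h := E.e_add (0, n) (0, -n) p
    have h2 : ((0, n) + (0, -n) : Deck) = (0, 0) := by simp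
    have h3 : fiberShift (-n) = -fiberShift n := by
      rw [← shift_neg]; simp
    rw [h2, hz] at h
    have h4 := congrArg Matrix.det h
    have h5 : p + fiberShift (-n) + fiberShift n = p := by rw [h3]; abel
    rw [det_mul, hn, h5, det_one] at h4
    have h6 := mul_left_cancel₀ (Complex.exp_ne_zero
      (Complex.I * ((φ p - φ (p + fiberShift (-n)) : ℝ) : ℂ))) (h4.symm.trans
        (b := 1) (c := Complex.exp (Complex.I * ((φ p - φ (p + fiberShift (-n)) : ℝ) : ℂ)) *
          Complex.exp (Complex.I * ((φ (p + fiberShift (-n)) - φ p : ℝ) : ℂ))) (by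
        rw [← Complex.exp_add, ← mul_add, ← Complex.ofReal_add]; simp))
    exact h6
  · intro i p
    rw [hdet, ver_eq_shift]

/-- The determinant times the adjoint of a unitary matrix is its adjugate, in entries. -/
theorem unitary_entries {e : Mat} (he : e ∈ unitaryGroup (Fin 2) ℂ) :
    e.det * star (e 0 0) = e 1 1 ∧ e.det * star (e 1 0) = -e 0 1 ∧
      e.det * star (e 0 1) = -e 1 0 ∧ e.det * star (e 1 1) = e 0 0 := by
  have hu := (Matrix.mem_unitaryGroup_iff (A := e)).1 he
  have hadj : e.det • star e = e.adjugate := by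
    calc e.det • star e = (e.adjugate * e) * star e := by
          rw [Matrix.adjugate_mul, smul_mul_assoc, one_mul]
      _ = _ := by rw [mul_assoc, hu, mul_one]
  rw [Matrix.adjugate_fin_two] at hadj
  have h : ∀ i j, e.det * star (e j i) = (!![e 1 1, -e 0 1; -e 1 0, e 0 0] : Mat) i j :=
    fun i j => congrFun (congrFun hadj i) j
  exact ⟨h 0 0, h 0 1, h 1 0, h 1 1⟩

/-- The squared length of a vector of `ℂ²`. -/
def vecNormSq (s : Fin 2 → ℂ) : ℝ := Complex.normSq (s 0) + Complex.normSq (s 1)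

theorem vecNormSq_pos {s : Fin 2 → ℂ} (h : s ≠ 0) : 0 < vecNormSq s := by
  rcases (Complex.normSq_nonneg (s 0)).lt_or_eq with h0 | h0
  · exact add_pos_of_pos_of_nonneg h0 (Complex.normSq_nonneg _)
  · refine add_pos_of_nonneg_of_pos h0.le (Complex.normSq_pos.2 fun h1 => h ?_)
    ext i; fin_cases i
    · exact Complex.normSq_eq_zero.1 h0.symm
    · exact h1

theorem vecNormSq_mulVec {e : Mat} (he : e ∈ unitaryGroup (Fin 2) ℂ) (s : Fin 2 → ℂ) :
    vecNormSq (e *ᵥ s) = vecNormSq s := by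
  have h : ∀ s : Fin 2 → ℂ, (vecNormSq s : ℂ) = star s ⬝ᵥ s := fun s => by
    simp [vecNormSq, dotProduct, Fin.sum_univ_two, Complex.normSq_eq_conj_mul_self]
  have hu := (Matrix.mem_unitaryGroup_iff' (A := e)).1 he
  rw [Matrix.star_eq_conjTranspose] at hu
  apply Complex.ofReal_injective
  rw [h, h, star_mulVec, ← dotProduct_mulVec, mulVec_mulVec, hu, one_mulVec]

/-- The unitary matrix with first column `s / ‖s‖` and determinant `δ`. -/
def completeFrame (s : Fin 2 → ℂ) (δ : ℂ) : Mat :=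
  (Real.sqrt (vecNormSq s))⁻¹ • !![s 0, -(δ * star (s 1)); s 1, δ * star (s 0)]

theorem completeFrame_mem {s : Fin 2 → ℂ} (hs : s ≠ 0) {δ : ℂ} (hδ : δ * star δ = 1) :
    completeFrame s δ ∈ unitaryGroup (Fin 2) ℂ := by
  rw [Matrix.mem_unitaryGroup_iff]
  set r : ℝ := (Real.sqrt (vecNormSq s))⁻¹ with hr
  have h1 : (r : ℂ) * r * (s 0 * star (s 0) + s 1 * star (s 1)) = 1 := by
    have h2 : s 0 * star (s 0) + s 1 * star (s 1) = (vecNormSq s : ℂ) := by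
      simp [vecNormSq, Complex.mul_conj]
    have h3 : r * r * vecNormSq s = 1 := by
      rw [hr, ← mul_inv, Real.mul_self_sqrt (vecNormSq_pos hs).le,
        inv_mul_cancel₀ (vecNormSq_pos hs).ne']
    rw [h2]; exact_mod_cast h3
  have hcr : star (r : ℂ) = r := Complex.conj_ofReal r
  have hentry : ∀ i j, completeFrame s δ i j
      = (r : ℂ) * (!![s 0, -(δ * star (s 1)); s 1, δ * star (s 0)] : Mat) i j := fun i j => by
    simp [completeFrame, hr]
  ext i j
  rw [Matrix.mul_apply, Fin.sum_univ_two]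
  simp only [Matrix.star_apply, hentry, star_mul', hcr]
  fin_cases i <;> fin_cases j <;>
    simp only [Fin.zero_eta, Fin.mk_one, Matrix.of_apply, Matrix.cons_val_zero,
      Matrix.cons_val_one, Matrix.cons_val', Matrix.cons_val_fin_one, star_neg, star_mul',
      star_star, Matrix.one_apply, if_true, zero_ne_one, one_ne_zero, if_false]
  · linear_combination h1 + (r : ℂ) * r * s 1 * star (s 1) * hδ
  · linear_combination -((r : ℂ) * r * s 0 * star (s 1)) * hδ
  · linear_combination -((r : ℂ) * r * s 1 * star (s 0)) * hδ
  · linear_combination h1 + (r : ℂ) * r * s 0 * star (s 0) * hδ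

theorem completeFrame_mulVec {e : Mat} (he : e ∈ unitaryGroup (Fin 2) ℂ) (s : Fin 2 → ℂ) (δ : ℂ) :
    completeFrame (e *ᵥ s) (e.det * δ) = e * completeFrame s δ := by
  obtain ⟨h00, h10, h01, h11⟩ := unitary_entries he
  rw [completeFrame, vecNormSq_mulVec he, completeFrame, mul_smul_comm]
  congr 1
  have hs : ∀ i, (e *ᵥ s) i = e i 0 * s 0 + e i 1 * s 1 := fun i => by
    simp [mulVec, dotProduct, Fin.sum_univ_two]
  ext i j
  rw [Matrix.mul_apply, Fin.sum_univ_two, hs, hs]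
  fin_cases i <;> fin_cases j <;>
    simp only [Fin.zero_eta, Fin.mk_one, Matrix.of_apply, Matrix.cons_val_zero,
      Matrix.cons_val_one, Matrix.cons_val', Matrix.cons_val_fin_one, star_add, star_mul']
  · linear_combination -(δ * star (s 0)) * h10 - δ * star (s 1) * h11
  · linear_combination δ * star (s 0) * h00 + δ * star (s 1) * h01

/-- If the determinant of the bundle is trivial along the fibers, then the bundle has a smooth
unitary frame over a neighborhood of any given fiber. -/
theorem exists_fiberFrame (E : UTwoBundle) {φ : Cover → ℝ} (hφ : ContDiff ℝ ∞ φ)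
    (hdet : ∀ n p, (E.e (0, n) p).det
      = Complex.exp (Complex.I * ((φ (p + fiberShift n) - φ p : ℝ) : ℂ))) (b₀ : Plane) :
    ∃ r : ℝ, 0 < r ∧ r < 1 / 2 ∧ ∃ S : Cover → Mat,
      ContDiffOn ℝ ∞ S (Metric.ball b₀ r ×ˢ Set.univ) ∧
      (∀ b ∈ Metric.ball b₀ r, ∀ x, S (b, x) ∈ unitaryGroup (Fin 2) ℂ) ∧
      ∀ n, ∀ p : Cover, S (p + fiberShift n) = E.e (0, n) p * S p := by
  obtain ⟨σ, hσ, hne⟩ := exists_fiberSection_ne_zero E b₀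
  have hev : ∀ᶠ b in 𝓝 b₀, ∀ x ∈ Set.Icc (0 : Plane) 1, σ (b, x) ≠ 0 :=
    isCompact_Icc.eventually_forall_of_forall_eventually fun x _ =>
      hσ.smooth.continuous.continuousAt.eventually_ne (hne x)
  obtain ⟨r, hr, hball⟩ := Metric.eventually_nhds_iff_ball.1 hev
  have hne' : ∀ b ∈ Metric.ball b₀ r, ∀ x, σ (b, x) ≠ 0 := by
    intro b hb x hx
    have h1 := hσ.equivariant (fun i => -⌊x i⌋) (b, x)
    rw [hx, mulVec_zero, fiberShift_apply] at h1
    refine hball b hb _ ⟨fun i => ?_, fun i => ?_⟩ h1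
    · simpa using Int.floor_le (x i)
    · have := Int.lt_floor_add_one (x i)
      simp only [Pi.add_apply, Int.cast_neg, Pi.one_apply]
      linarith
  have hsub : Metric.ball b₀ (min r (1 / 4)) ⊆ Metric.ball b₀ r :=
    Metric.ball_subset_ball (min_le_left _ _)
  refine ⟨min r (1 / 4), by positivity, by
    have := min_le_right r (1 / 4); linarith,
    fun p => completeFrame (σ p) (Complex.exp (Complex.I * (φ p : ℂ))), ?_, ?_, ?_⟩
  · have hc : ∀ i, ContDiff ℝ ∞ fun p => σ p i := fun i => contDiff_pi.1 hσ.smooth i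
    have hsc : ∀ i, ContDiff ℝ ∞ fun p => star (σ p i) := fun i =>
      Complex.conjCLE.contDiff.comp (hc i)
    have hδ : ContDiff ℝ ∞ fun p => Complex.exp (Complex.I * (φ p : ℂ)) :=
      (contDiff_const.mul (Complex.ofRealCLM.contDiff.comp hφ)).cexp
    have hns : ContDiff ℝ ∞ fun p => vecNormSq (σ p) := by
      have h2 : ∀ i, ContDiff ℝ ∞ fun p => Complex.normSq (σ p i) := fun i => by
        have h3 : ∀ z : ℂ, Complex.normSq z = (star z * z).re := fun z => by
          simp [Complex.normSq_apply]
        simp only [h3]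
        exact Complex.reCLM.contDiff.comp ((hsc i).mul (hc i))
      exact (h2 0).add (h2 1)
    have hr : ContDiffOn ℝ ∞ (fun p => (Real.sqrt (vecNormSq (σ p)))⁻¹)
        (Metric.ball b₀ (min r (1 / 4)) ×ˢ Set.univ) := by
      have hp : ∀ p ∈ Metric.ball b₀ (min r (1 / 4)) ×ˢ (Set.univ : Set Plane),
          vecNormSq (σ p) ≠ 0 := fun p hp => (vecNormSq_pos (hne' p.1 (hsub hp.1) p.2)).ne'
      refine (hns.contDiffOn.sqrt hp).inv fun p hpm => ?_
      exact (Real.sqrt_pos.2 (vecNormSq_pos (hne' p.1 (hsub hpm.1) p.2))).ne'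
    refine hr.smul (contDiffOn_matrix fun i j => ContDiff.contDiffOn ?_)
    fin_cases i <;> fin_cases j
    · exact hc 0
    · exact (hδ.mul (hsc 1)).neg
    · exact hc 1
    · exact hδ.mul (hsc 0)
  · intro b hb x
    refine completeFrame_mem (hne' b (hsub hb) x) ?_
    have : star (Complex.exp (Complex.I * (φ (b, x) : ℂ)))
        = Complex.exp (-(Complex.I * (φ (b, x) : ℂ))) := by
      rw [Complex.star_def, ← Complex.exp_conj]; simp
    rw [this, ← Complex.exp_add]; simp
  · intro n p
    simp only
    rw [← completeFrame_mulVec (E.e_unitary _ _), hσ.equivariant, hdet, ← Complex.exp_add]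
    congr 2; push_cast; ring

/-! ### Small charts of the base torus -/

/-- The image in the base torus of a ball in the plane. -/
def baseChart (b₀ : Plane) (r : ℝ) : Set (UnitAddTorus (Fin 2)) :=
  (fun b : Plane => fun i => (b i : UnitAddCircle)) '' Metric.ball b₀ r

theorem isOpen_baseChart (b₀ : Plane) (r : ℝ) : IsOpen (baseChart b₀ r) := by
  have h : IsOpenMap (Pi.map fun _ : Fin 2 => fun t : ℝ => (t : UnitAddCircle)) :=
    IsOpenMap.piMap (fun _ => QuotientAddGroup.isOpenMap_coe) (by simp)
  exact h _ Metric.isOpen_ball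

/-- The lattice vector closest to `b - b₀`. -/
def sheetIndex (b₀ b : Plane) (i : Fin 2) : ℤ := round (b i - b₀ i)

/-- The translate of `b` closest to `b₀`. -/
def sheetPoint (b₀ b : Plane) : Plane := b - fun i => (sheetIndex b₀ b i : ℝ)

theorem sheetIndex_eq {b₀ b : Plane} {r : ℝ} (hr : r < 1 / 2) {n : Fin 2 → ℤ}
    (h : (b - fun i => (n i : ℝ)) ∈ Metric.ball b₀ r) : sheetIndex b₀ b = n := by
  ext i
  have h1 := (dist_le_pi_dist (b - fun i => (n i : ℝ)) b₀ i).trans_lt (Metric.mem_ball.1 h)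
  rw [Real.dist_eq, abs_lt] at h1
  simp only [Pi.sub_apply] at h1
  rw [sheetIndex, round_eq, Int.floor_eq_iff]
  constructor <;> linarith [h1.1, h1.2]

theorem mem_overBase_iff {b₀ : Plane} {r : ℝ} (hr : r < 1 / 2) {p : Cover} :
    p ∈ overBase (baseChart b₀ r) ↔ sheetPoint b₀ p.1 ∈ Metric.ball b₀ r := by
  constructor
  · rintro ⟨b, hb, hbp⟩
    have h1 : ∀ i, ∃ n : ℤ, p.1 i = b i + n := fun i => by
      have h2 : (b i : UnitAddCircle) = (p.1 i : UnitAddCircle) := congrFun hbp i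
      have h3 : ((p.1 i - b i : ℝ) : UnitAddCircle) = 0 := by
        rw [AddCircle.coe_sub, h2, sub_self]
      obtain ⟨n, hn⟩ := (AddCircle.coe_eq_zero_iff 1).1 h3
      exact ⟨n, by rw [zsmul_one] at hn; linarith⟩
    choose n hn using h1
    have h2 : (p.1 - fun i => (n i : ℝ)) = b := by ext i; simp [hn]
    rw [sheetPoint, sheetIndex_eq hr (n := n) (by rwa [h2]), h2]
    exact hb
  · intro h
    refine ⟨_, h, ?_⟩
    ext i
    simp [sheetPoint]

theorem isOpen_overBase {U : Set (UnitAddTorus (Fin 2))} (hU : IsOpen U) : IsOpen (overBase U) := by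
  refine hU.preimage (continuous_pi fun i => ?_)
  exact (AddCircle.continuous_mk' 1).comp ((continuous_apply i).comp continuous_fst)

theorem sheetIndex_eventuallyEq {b₀ : Plane} {r : ℝ} (hr : r < 1 / 2) {b : Plane}
    (hb : sheetPoint b₀ b ∈ Metric.ball b₀ r) :
    ∀ᶠ b' in 𝓝 b, sheetIndex b₀ b' = sheetIndex b₀ b := by
  have hc : Continuous fun b' : Plane => b' - fun i => (sheetIndex b₀ b i : ℝ) := by fun_prop
  filter_upwards [hc.continuousAt.eventually_mem (Metric.isOpen_ball.mem_nhds hb)] with b' hb'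
  exact sheetIndex_eq hr hb'

theorem sheetIndex_add {b₀ b : Plane} (n : Fin 2 → ℤ) :
    sheetIndex b₀ (b + fun i => (n i : ℝ)) = sheetIndex b₀ b + n := by
  ext i
  simp only [sheetIndex, Pi.add_apply, add_sub_right_comm, round_add_intCast]

theorem sheetPoint_add {b₀ b : Plane} (n : Fin 2 → ℤ) :
    sheetPoint b₀ (b + fun i => (n i : ℝ)) = sheetPoint b₀ b := by
  ext i
  simp [sheetPoint, sheetIndex_add]

/-- A frame near one fiber in the universal cover extends to an equivariant frame over all
translates. -/
theorem exists_isUnitaryFrame (E : UTwoBundle) {φ : Cover → ℝ} (hφ : ContDiff ℝ ∞ φ)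
    (hdet : ∀ n p, (E.e (0, n) p).det
      = Complex.exp (Complex.I * ((φ (p + fiberShift n) - φ p : ℝ) : ℂ))) (b₀ : Plane) :
    ∃ r : ℝ, 0 < r ∧ r < 1 / 2 ∧ ∃ s : Cover → Mat, IsUnitaryFrame E (baseChart b₀ r) s := by
  obtain ⟨r, hr, hr2, S, hS, hSu, hSe⟩ := exists_fiberFrame E hφ hdet b₀
  refine ⟨r, hr, hr2, fun p => E.e (sheetIndex b₀ p.1, 0) (sheetPoint b₀ p.1, p.2)
    * S (sheetPoint b₀ p.1, p.2), ?_, ?_, ?_⟩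
  · intro p hp
    have hp' := (mem_overBase_iff hr2).1 hp
    refine ContDiffAt.contDiffWithinAt ?_
    set m := sheetIndex b₀ p.1 with hm
    have hτ : ContDiff ℝ ∞ fun q : Cover => ((q.1 - fun i => (m i : ℝ), q.2) : Cover) :=
      (contDiff_fst.sub contDiff_const).prodMk contDiff_snd
    have hloc : (fun p : Cover => E.e (sheetIndex b₀ p.1, 0) (sheetPoint b₀ p.1, p.2)
        * S (sheetPoint b₀ p.1, p.2)) =ᶠ[𝓝 p] fun q =>
        E.e (m, 0) (q.1 - fun i => (m i : ℝ), q.2) * S (q.1 - fun i => (m i : ℝ), q.2) := by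
      filter_upwards [continuous_fst.continuousAt.eventually
        (sheetIndex_eventuallyEq hr2 hp')] with q hq
      rw [sheetPoint, hq]
    refine ContDiffAt.congr_of_eventuallyEq ?_ hloc
    refine ((E.e_smooth _).comp hτ).contDiffAt.mul (ContDiffAt.comp p ?_ hτ.contDiffAt)
    exact hS.contDiffAt ((Metric.isOpen_ball.prod isOpen_univ).mem_nhds ⟨hp', trivial⟩)
  · intro p hp
    exact mul_mem (E.e_unitary _ _) (hSu _ ((mem_overBase_iff hr2).1 hp) _)
  · rintro ⟨g, n⟩ ⟨b, x⟩ hp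
    have e1 : ((b, x) : Cover) + Deck.shift (g, n)
        = (b + fun i => (g i : ℝ), x + fun i => (n i : ℝ)) := rfl
    simp only [e1, sheetIndex_add, sheetPoint_add]
    rw [← fiberShift_apply, hSe, ← mul_assoc, ← E.e_add, ← mul_assoc]
    have e2 : ((b, x) : Cover) = (sheetPoint b₀ b, x) + Deck.shift (sheetIndex b₀ b, 0) := by
      ext i <;> simp [sheetPoint, Deck.shift]
    conv_rhs => rw [e2]
    have e3 : ((sheetIndex b₀ b + g, 0) + (0, n) : Deck) = (g, n) + (sheetIndex b₀ b, 0) := by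
      ext i <;> simp [add_comm]
    rw [← E.e_add, e3]

/-! ### The central part in a frame -/

/-- A smooth potential of a closed smooth one-form on a vector space. -/
theorem exists_potential {X : Type} [NormedAddCommGroup X] [NormedSpace ℝ X]
    {a : X → X →L[ℝ] ℝ} (ha : ContDiff ℝ ∞ a)
    (hs : ∀ x u v, fderiv ℝ a x u v = fderiv ℝ a x v u) :
    ∃ θ : X → ℝ, ContDiff ℝ ∞ θ ∧ ∀ x, HasFDerivAt θ (a x) x := by
  obtain ⟨θ, hθ⟩ := convex_univ.exists_forall_hasFDerivAt_of_fderiv_symmetric isOpen_univ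
    (ha.differentiable (by simp)).differentiableOn fun x _ => hs x
  refine ⟨θ, contDiff_infty_iff_fderiv.2 ⟨fun x => (hθ x trivial).differentiableAt, ?_⟩,
    fun x => hθ x trivial⟩
  rwa [show fderiv ℝ θ = a from funext fun x => (hθ x trivial).fderiv]

section CentralPart

variable {E : UTwoBundle} {U : Set (UnitAddTorus (Fin 2))} {s : Cover → Mat}

theorem centralPart_apply (a : Cover →L[ℝ] Mat) (v : Cover) :
    centralPart a v = (1 / 2 : ℂ) * Matrix.trace (a v) := by
  simp [centralPart]

theorem UTwoConnection.inFrame_apply (Ξ : UTwoConnection E) (s : Cover → Mat) (p v : Cover) :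
    Ξ.inFrame s p v = (s p)ᴴ * Ξ.A p v * s p + (s p)ᴴ * fderiv ℝ s p v := by
  simp [UTwoConnection.inFrame]

theorem star_exp_mul_exp (t : ℝ) :
    star (Complex.exp (-(Complex.I * t))) * Complex.exp (-(Complex.I * t)) = 1 := by
  rw [Complex.star_def, ← Complex.exp_conj, ← Complex.exp_add]; simp

/-- Multiplication of the frame by a phase `exp (-iψ)` changes the central part by `-i dψ`. -/
theorem centralPart_inFrame_smul (hU : IsOpen U) (hs : IsUnitaryFrame E U s) (Ξ : UTwoConnection E)
    {ψ : Cover → ℝ} {p : Cover} (hp : p ∈ overBase U) {ψ' : Cover →L[ℝ] ℝ}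
    (hψ : HasFDerivAt ψ ψ' p) (v : Cover) :
    centralPart (Ξ.inFrame (fun p => Complex.exp (-(Complex.I * (ψ p : ℂ))) • s p) p) v
      = centralPart (Ξ.inFrame s p) v - Complex.I * (ψ' v : ℂ) := by
  have hO := isOpen_overBase hU
  have hsd : HasFDerivAt s (fderiv ℝ s p) p :=
    ((hs.smooth.contDiffAt (hO.mem_nhds hp)).differentiableAt (by simp)).hasFDerivAt
  have hz : HasFDerivAt (fun p => Complex.exp (-(Complex.I * (ψ p : ℂ)))) _ p :=
    ((Complex.ofRealCLM.hasFDerivAt.comp p hψ).const_mul Complex.I).neg.cexp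
  have hu := (Matrix.mem_unitaryGroup_iff' (A := s p)).1 (hs.unitary p hp)
  rw [Matrix.star_eq_conjTranspose] at hu
  have hd : fderiv ℝ (fun p => Complex.exp (-(Complex.I * (ψ p : ℂ))) • s p) p v
      = Complex.exp (-(Complex.I * (ψ p : ℂ))) • fderiv ℝ s p v
        + (-(Complex.I * (ψ' v : ℂ)) * Complex.exp (-(Complex.I * (ψ p : ℂ)))) • s p := by
    rw [(hz.fun_smul hsd).fderiv]
    simp
    ring_nf
  have hzz := star_exp_mul_exp (ψ p)
  rw [centralPart_apply, centralPart_apply, Ξ.inFrame_apply, Ξ.inFrame_apply, hd]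
  generalize Complex.exp (-(Complex.I * (ψ p : ℂ))) = z at hzz ⊢
  rw [conjTranspose_smul]
  simp only [smul_mul_assoc, mul_smul_comm, mul_add, smul_smul, hu]
  rw [show z * star z = 1 by rw [mul_comm, hzz],
    show -(Complex.I * (ψ' v : ℂ)) * z * star z = -(Complex.I * (ψ' v : ℂ)) by
      rw [mul_assoc, mul_comm z, hzz, mul_one]]
  simp only [one_smul, trace_add, trace_smul, trace_one, Fintype.card_fin, smul_eq_mul]
  push_cast
  ring

/-- The central parts of two connections in the same frame differ by half the difference of their
traces. -/
theorem centralPart_inFrame_sub (hs : IsUnitaryFrame E U s) (Ξ Ξ' : UTwoConnection E)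
    {p : Cover} (hp : p ∈ overBase U) (v : Cover) :
    centralPart (Ξ.inFrame s p) v = centralPart (Ξ'.inFrame s p) v
      + Complex.I * ((1 / 2 * (Ξ.traceForm p v - Ξ'.traceForm p v) : ℝ) : ℂ) := by
  have hu := (Matrix.mem_unitaryGroup_iff (A := s p)).1 (hs.unitary p hp)
  rw [Matrix.star_eq_conjTranspose] at hu
  have h : ∀ Ξ : UTwoConnection E, Matrix.trace ((s p)ᴴ * Ξ.A p v * s p)
      = Complex.I * (Ξ.traceForm p v : ℂ) := fun Ξ => by
    rw [Matrix.trace_mul_comm, ← mul_assoc, hu, one_mul, Ξ.trace_A]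
  rw [centralPart_apply, centralPart_apply, Ξ.inFrame_apply, Ξ'.inFrame_apply, trace_add, trace_add,
    h, h]
  push_cast
  ring

theorem contDiffOn_mulLeftRight {V : Set Cover} {f g : Cover → Mat} (hf : ContDiffOn ℝ ∞ f V)
    (hg : ContDiffOn ℝ ∞ g V) :
    ContDiffOn ℝ ∞ (fun p => ContinuousLinearMap.mulLeftRight ℝ Mat (f p) (g p)) V := by
  have h1 : ContDiffOn ℝ ∞ (fun p => ContinuousLinearMap.mul ℝ Mat (f p)) V :=
    (ContinuousLinearMap.mul ℝ Mat).contDiff.comp_contDiffOn hf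
  have h2 : ContDiffOn ℝ ∞ (fun p => (ContinuousLinearMap.mul ℝ Mat).flip (g p)) V :=
    (ContinuousLinearMap.mul ℝ Mat).flip.contDiff.comp_contDiffOn hg
  refine (h2.clm_comp h1).congr fun p _ => ContinuousLinearMap.ext fun z => ?_
  simp

theorem contDiffOn_inFrame (hU : IsOpen U) (hs : IsUnitaryFrame E U s) (Ξ : UTwoConnection E) :
    ContDiffOn ℝ ∞ (Ξ.inFrame s) (overBase U) := by
  have hstar : ContDiffOn ℝ ∞ (fun p => (s p)ᴴ) (overBase U) :=
    (starL' ℝ : Mat ≃L[ℝ] Mat).contDiff.comp_contDiffOn hs.smooth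
  have hds : ContDiffOn ℝ ∞ (fderiv ℝ s) (overBase U) :=
    hs.smooth.fderiv_of_isOpen (isOpen_overBase hU) (by simp)
  have h1 := contDiffOn_mulLeftRight hstar hs.smooth
  have h2 : ContDiffOn ℝ ∞ (fun p => ContinuousLinearMap.mul ℝ Mat (s p)ᴴ) (overBase U) :=
    (ContinuousLinearMap.mul ℝ Mat).contDiff.comp_contDiffOn hstar
  exact (h1.clm_comp Ξ.A_smooth.contDiffOn).add (h2.clm_comp hds)

theorem contDiffOn_centralPart {V : Set Cover} {a : Cover → Cover →L[ℝ] Mat}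
    (ha : ContDiffOn ℝ ∞ a V) : ContDiffOn ℝ ∞ (fun p => centralPart (a p)) V := by
  have h : ContDiffOn ℝ ∞ (fun p =>
      ((Matrix.traceLinearMap (Fin 2) ℝ ℂ).toContinuousLinearMap : Mat →L[ℝ] ℂ) ∘L a p) V :=
    contDiffOn_const.clm_comp ha
  exact h.const_smul (1 / 2 : ℝ)

theorem contDiffOn_centralPart_inFrame (hU : IsOpen U) (hs : IsUnitaryFrame E U s)
    (Ξ : UTwoConnection E) :
    ContDiffOn ℝ ∞ (fun p => centralPart (Ξ.inFrame s p)) (overBase U) :=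
  contDiffOn_centralPart (contDiffOn_inFrame hU hs Ξ)

/-- The base coordinates of the points of `π⁻¹(U)`. -/
def baseLift (U : Set (UnitAddTorus (Fin 2))) : Set Plane :=
  {b | (fun i => (b i : UnitAddCircle)) ∈ U}

theorem isOpen_baseLift (hU : IsOpen U) : IsOpen (baseLift U) :=
  hU.preimage (continuous_pi fun i => (AddCircle.continuous_mk' 1).comp (continuous_apply i))

theorem overBase_eq_prod : overBase U = baseLift U ×ˢ Set.univ := by
  ext p; simp [overBase, baseLift]

theorem contDiffOn_fiberwiseConstantPart (hU : IsOpen U) {a : Cover → Cover →L[ℝ] ℂ}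
    (ha : ContDiffOn ℝ ∞ a (overBase U)) :
    ContDiffOn ℝ ∞ (fiberwiseConstantPart a) (overBase U) := by
  rw [overBase_eq_prod] at ha ⊢
  exact (contDiffOn_setIntegral (isOpen_baseLift hU) isCompact_Icc ha).comp contDiffOn_fst
    fun p hp => hp.1

end CentralPart

/-- Translating by constants tending to zero is smooth convergence. -/
theorem convergesSmoothly_of_eq_add {U : Set (UnitAddTorus (Fin 2))} (hU : IsOpen U)
    {a : ℕ → Cover → Cover →L[ℝ] ℂ} {α : Cover → Cover →L[ℝ] ℂ}
    (hα : ContDiffOn ℝ ∞ α (overBase U)) {D : ℕ → Cover →L[ℝ] ℂ}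
    (hD : Tendsto D atTop (𝓝 0)) (h : ∀ k, ∀ p ∈ overBase U, a k p = α p + D k) :
    ConvergesSmoothly U a α := by
  intro r
  have hO := isOpen_overBase hU
  rw [Metric.tendstoUniformlyOn_iff]
  intro η hη
  have hD' := (tendsto_zero_iff_norm_tendsto_zero.1 hD).eventually_lt_const hη
  filter_upwards [hD'] with k hk p hp
  have hloc : a k =ᶠ[𝓝 p] fun q => α q + D k := by
    filter_upwards [hO.mem_nhds hp] with q hq using h k q hq
  have hαp : ContDiffAt ℝ r α p := (hα.contDiffAt (hO.mem_nhds hp)).of_le (by exact_mod_cast le_top)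
  have h1 : iteratedFDeriv ℝ r (a k) p
      = iteratedFDeriv ℝ r α p + iteratedFDeriv ℝ r (fun _ => D k) p := by
    rw [(hloc.iteratedFDeriv ℝ r).eq_of_nhds]
    exact fun_iteratedFDeriv_add_apply hαp contDiffAt_const
  rw [h1, dist_eq_norm, sub_add_cancel_left, norm_neg]
  rcases r with _ | r
  · rwa [norm_iteratedFDeriv_zero]
  · rw [iteratedFDeriv_succ_const]; simpa using hη

/-! ### Fixing the gauge over a small chart -/

/-- The purely imaginary constant one-form `i (c₀ dx₀ + c₁ dx₁)`. -/
def fiberForm (c : Plane) : Cover →L[ℝ] ℂ :=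
  ∑ j, c j • (Complex.I • (Complex.ofRealCLM ∘L .proj j ∘L .snd ℝ Plane Plane))

theorem fiberForm_apply (c : Plane) (v : Cover) :
    fiberForm c v = Complex.I * ((∑ j, c j * v.2 j : ℝ) : ℂ) := by
  simp [fiberForm, Fin.sum_univ_two]
  ring

theorem fiberForm_sub (c c' : Plane) : fiberForm c - fiberForm c' = fiberForm (c - c') := by
  refine ContinuousLinearMap.ext fun v => ?_
  rw [_root_.sub_apply, fiberForm_apply, fiberForm_apply, fiberForm_apply]
  simp only [Fin.sum_univ_two, Pi.sub_apply]
  push_cast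
  ring

theorem continuous_fiberForm : Continuous fiberForm := by
  unfold fiberForm
  fun_prop

/-- The phase by which the frame over a chart is changed: a potential `θ` of the base part of
a closed form, and a winding `n` along the fibers. The base point is moved into the ball in which
the chart is centered, so that the phase is invariant under the deck group of the base. -/
def chartPhase (b₀ : Plane) (θ : Plane → ℝ) (n : Fin 2 → ℤ) (p : Cover) : ℝ :=
  1 / 2 * θ (sheetPoint b₀ p.1) + 2 * Real.pi * ∑ j, n j * p.2 j

section ChartPhase

variable {b₀ : Plane} {r : ℝ} {θ : Plane → ℝ} {n : Fin 2 → ℤ}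

theorem chartPhase_eventuallyEq (hr : r < 1 / 2) {p : Cover} (hp : p ∈ overBase (baseChart b₀ r)) :
    chartPhase b₀ θ n =ᶠ[𝓝 p] fun q =>
      1 / 2 * θ (q.1 - fun i => (sheetIndex b₀ p.1 i : ℝ)) + 2 * Real.pi * ∑ j, n j * q.2 j := by
  filter_upwards [continuous_fst.continuousAt.eventually
    (sheetIndex_eventuallyEq hr ((mem_overBase_iff hr).1 hp))] with q hq
  rw [chartPhase, sheetPoint, hq]

theorem contDiffOn_chartPhase (hr : r < 1 / 2) (hθ : ContDiff ℝ ∞ θ) :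
    ContDiffOn ℝ ∞ (chartPhase b₀ θ n) (overBase (baseChart b₀ r)) := by
  intro p hp
  refine (ContDiffAt.congr_of_eventuallyEq (ContDiff.contDiffAt ?_)
    (chartPhase_eventuallyEq hr hp)).contDiffWithinAt
  have h1 : ContDiff ℝ ∞ fun q : Cover => θ (q.1 - fun i => (sheetIndex b₀ p.1 i : ℝ)) :=
    hθ.comp (contDiff_fst.sub contDiff_const)
  fun_prop

theorem hasFDerivAt_chartPhase (hr : r < 1 / 2) {a : Plane → Plane →L[ℝ] ℝ}
    (ha : ∀ (i : Fin 2) (b : Plane), a (b + Pi.single i 1) = a b)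
    (hθ : ∀ b, HasFDerivAt θ (a b) b) {p : Cover} (hp : p ∈ overBase (baseChart b₀ r)) :
    HasFDerivAt (chartPhase b₀ θ n) ((1 / 2 : ℝ) • (a p.1 ∘L .fst ℝ Plane Plane)
      + (2 * Real.pi) • ∑ j, (n j : ℝ) • (.proj j ∘L .snd ℝ Plane Plane)) p := by
  refine HasFDerivAt.congr_of_eventuallyEq ?_ (chartPhase_eventuallyEq hr hp)
  have e : a (p.1 - fun i => (sheetIndex b₀ p.1 i : ℝ)) = a p.1 := by
    have := periodic_of_generators ha (sheetIndex b₀ p.1) (p.1 - fun i => (sheetIndex b₀ p.1 i : ℝ))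
    rw [← this, sub_add_cancel]
  have h1 : HasFDerivAt (fun q : Cover => θ (q.1 - fun i => (sheetIndex b₀ p.1 i : ℝ)))
      (a p.1 ∘L .fst ℝ Plane Plane) p := by
    rw [← e]
    exact (hθ _).comp p (hasFDerivAt_fst.sub_const _)
  have h2 : ∀ j : Fin 2, HasFDerivAt (fun q : Cover => (n j : ℝ) * q.2 j)
      ((n j : ℝ) • (.proj j ∘L .snd ℝ Plane Plane)) p := fun j =>
    ((ContinuousLinearMap.proj (R := ℝ) (φ := fun _ : Fin 2 => ℝ) j
      ∘L .snd ℝ Plane Plane).hasFDerivAt).const_mul (n j : ℝ)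
  exact (h1.const_mul _).add ((HasFDerivAt.fun_sum fun j _ => h2 j).const_mul _)

theorem chartPhase_add (γ : Deck) (p : Cover) :
    chartPhase b₀ θ n (p + γ.shift)
      = chartPhase b₀ θ n p + ((∑ j, n j * γ.2 j : ℤ) : ℝ) * (2 * Real.pi) := by
  have e : (p + γ.shift).1 = p.1 + fun i => (γ.1 i : ℝ) := rfl
  have e2 : ∀ j, (p + γ.shift).2 j = p.2 j + γ.2 j := fun j => rfl
  rw [chartPhase, e, sheetPoint_add, chartPhase]
  simp only [e2, Fin.sum_univ_two]
  push_cast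
  ring

/-- Phases with integral winding along the fibers act on the unitary frames over a chart. -/
theorem IsUnitaryFrame.chartPhase_smul {E : UTwoBundle} {s : Cover → Mat} (hr : r < 1 / 2)
    (hs : IsUnitaryFrame E (baseChart b₀ r) s) (hθ : ContDiff ℝ ∞ θ) :
    IsUnitaryFrame E (baseChart b₀ r)
      fun p => Complex.exp (-(Complex.I * (chartPhase b₀ θ n p : ℂ))) • s p where
  smooth := by
    have h : ContDiffOn ℝ ∞ (fun p => Complex.exp (-(Complex.I * (chartPhase b₀ θ n p : ℂ))))
        (overBase (baseChart b₀ r)) :=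
      (contDiffOn_const.mul
        (Complex.ofRealCLM.contDiff.comp_contDiffOn (contDiffOn_chartPhase hr hθ))).neg.cexp
    exact h.smul hs.smooth
  unitary p hp := by
    rw [Matrix.mem_unitaryGroup_iff', star_smul, smul_mul_smul_comm, star_exp_mul_exp,
      (Matrix.mem_unitaryGroup_iff').1 (hs.unitary p hp), one_smul]
  equivariant γ p hp := by
    rw [hs.equivariant γ p hp, mul_smul_comm, chartPhase_add]
    congr 1
    refine Complex.exp_eq_exp_iff_exists_int.2 ⟨-∑ j, n j * γ.2 j, ?_⟩
    push_cast
    ring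

end ChartPhase

section Gauge

variable {E : UTwoBundle}

/-- If the averaged trace difference of two connections is a closed form on the base plus constant
fiber coefficients, a phase absorbs the base part and all but a bounded part of the fiber
coefficients. -/
theorem exists_frame_fiberwiseConstantPart_eq (Ξ Ξ' : UTwoConnection E) {b₀ : Plane} {r : ℝ}
    (hr : r < 1 / 2) {s : Cover → Mat} (hs : IsUnitaryFrame E (baseChart b₀ r) s)
    (hver : ∀ j b, traceDiff Ξ Ξ' b (ver j) = traceDiff Ξ Ξ' 0 (ver j))
    (hhor : ∀ b w w' : Plane, fderiv ℝ (traceDiff Ξ Ξ') b w (w', 0)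
      = fderiv ℝ (traceDiff Ξ Ξ') b w' (w, 0)) :
    ∃ s' : Cover → Mat, IsUnitaryFrame E (baseChart b₀ r) s' ∧
      ∃ c ∈ Set.Icc (0 : Plane) fun _ => 2 * Real.pi, ∀ p ∈ overBase (baseChart b₀ r),
        fiberwiseConstantPart (fun p => centralPart (Ξ.inFrame s' p)) p
          = fiberwiseConstantPart (fun p => centralPart (Ξ'.inFrame s p)) p + fiberForm c := by
  have hD := contDiff_traceDiff Ξ Ξ'
  have ha : ContDiff ℝ ∞ fun b => traceDiff Ξ Ξ' b ∘L .inl ℝ Plane Plane :=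
    hD.clm_comp contDiff_const
  have hda : ∀ b w w' : Plane, fderiv ℝ (fun b => traceDiff Ξ Ξ' b ∘L .inl ℝ Plane Plane) b w w'
      = fderiv ℝ (traceDiff Ξ Ξ') b w (w', 0) := fun b w w' => by
    have h1 := (hD.differentiable (by simp) b).hasFDerivAt.clm_comp
      (hasFDerivAt_const (ContinuousLinearMap.inl ℝ Plane Plane) b)
    rw [h1.fderiv]
    simp
  obtain ⟨θ, hθ, hθ'⟩ := exists_potential ha fun b w w' => by rw [hda, hda, hhor]
  set τ : Plane := fun j => traceDiff Ξ Ξ' 0 (ver j) with hτ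
  have hπ := Real.pi_pos
  -- `2π n` is the winding of the phase, so half of the trace is reduced modulo `2π`
  set n : Fin 2 → ℤ := fun j => ⌊τ j / (4 * Real.pi)⌋ with hn
  refine ⟨_, hs.chartPhase_smul (n := n) hr hθ, fun j => 1 / 2 * τ j - 2 * Real.pi * n j,
    ⟨fun j => ?_, fun j => ?_⟩, fun p hp => ?_⟩
  · have := Int.floor_le (τ j / (4 * Real.pi))
    rw [le_div_iff₀ (by positivity)] at this
    simp only [Pi.zero_apply, hn]
    linarith
  · have := (Int.lt_floor_add_one (τ j / (4 * Real.pi))).le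
    rw [div_le_iff₀ (by positivity)] at this
    simp only [hn]
    linarith
  have hU := isOpen_baseChart b₀ r
  set κ : Cover →L[ℝ] ℝ := (1 / 2 : ℝ) • ((traceDiff Ξ Ξ' p.1 ∘L .inl ℝ Plane Plane)
    ∘L .fst ℝ Plane Plane) + (2 * Real.pi) • ∑ j, (n j : ℝ) • (.proj j ∘L .snd ℝ Plane Plane)
    with hκ
  set I' : (Cover →L[ℝ] ℝ) →L[ℝ] (Cover →L[ℝ] ℂ) :=
    ContinuousLinearMap.compL ℝ Cover ℝ ℂ (Complex.I • Complex.ofRealCLM) with hI'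
  have hI'a : ∀ (f : Cover →L[ℝ] ℝ) v, I' f v = Complex.I * (f v : ℂ) := fun f v => by simp [hI']
  set g : Cover → Cover →L[ℝ] ℝ := fun q => Ξ.traceForm q - Ξ'.traceForm q with hg
  have hgc : Continuous g := (contDiff_traceForm_sub Ξ Ξ').continuous
  have hpt : ∀ t : Plane, (p.1, t) ∈ overBase (baseChart b₀ r) := fun t => hp
  have key : ∀ t : Plane, centralPart (Ξ.inFrame (fun p =>
        Complex.exp (-(Complex.I * (chartPhase b₀ θ n p : ℂ))) • s p) (p.1, t))
      = centralPart (Ξ'.inFrame s (p.1, t)) + I' ((1 / 2 : ℝ) • g (p.1, t) - κ) := fun t => by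
    refine ContinuousLinearMap.ext fun v => ?_
    have hκt : HasFDerivAt (chartPhase b₀ θ n) κ (p.1, t) := hasFDerivAt_chartPhase hr
      (fun i b => by rw [traceDiff_periodic]) hθ' (hpt t)
    rw [centralPart_inFrame_smul hU hs Ξ (hpt t) hκt, centralPart_inFrame_sub hs Ξ Ξ' (hpt t),
      _root_.add_apply (centralPart _), hI'a, _root_.sub_apply]
    simp only [hg, _root_.smul_apply, _root_.sub_apply, smul_eq_mul]
    push_cast
    ring
  have hc0 : Continuous fun t : Plane => centralPart (Ξ'.inFrame s (p.1, t)) :=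
    (contDiffOn_centralPart_inFrame hU hs Ξ').continuousOn.comp_continuous (by fun_prop) hpt
  have hint : IntegrableOn (fun t : Plane => centralPart (Ξ'.inFrame s (p.1, t)))
      (Set.Icc (0 : Plane) 1) := hc0.continuousOn.integrableOn_compact isCompact_Icc
  have hg2 : Continuous fun q : Cover => (1 / 2 : ℝ) • g q := hgc.const_smul (1 / 2 : ℝ)
  have hc1 : Continuous fun q : Cover => (1 / 2 : ℝ) • g q - κ :=
    hg2.sub (continuous_const (y := κ))
  have e1 : fiberAverage (fun q => I' ((1 / 2 : ℝ) • g q - κ)) p.1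
      = I' ((1 / 2 : ℝ) • traceDiff Ξ Ξ' p.1 - κ) := by
    rw [← map_fiberAverage I' hc1]
    congr 1
    have h2 : fiberAverage (fun q => (1 / 2 : ℝ) • g q) p.1 = (1 / 2 : ℝ) • traceDiff Ξ Ξ' p.1 :=
      integral_smul _ _
    rw [← h2]
    have h3 : fiberAverage (fun _ => κ) p.1 = κ := fiberAverage_const κ p.1
    conv_rhs => rw [← h3]
    exact integral_sub (integrableOn_fiber hg2 _)
      (integrableOn_fiber continuous_const p.1)
  have e2 : fiberwiseConstantPart (fun p => centralPart (Ξ.inFrame (fun p =>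
        Complex.exp (-(Complex.I * (chartPhase b₀ θ n p : ℂ))) • s p) p)) p
      = fiberwiseConstantPart (fun p => centralPart (Ξ'.inFrame s p)) p
        + fiberAverage (fun q => I' ((1 / 2 : ℝ) • g q - κ)) p.1 := by
    rw [fiberwiseConstantPart, fiberwiseConstantPart, fiberAverage]
    simp only [key]
    exact integral_add hint (integrableOn_fiber (I'.continuous.comp hc1) _)
  rw [e2, e1]
  congr 1
  refine ContinuousLinearMap.ext fun v => ?_
  have hv : v = (v.1, 0) + (v.2 0 • ver 0 + v.2 1 • ver 1) := by
    rw [← vertical_eq]; simp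
  have hTv : traceDiff Ξ Ξ' p.1 v = traceDiff Ξ Ξ' p.1 (v.1, 0) + (v.2 0 * τ 0 + v.2 1 * τ 1) := by
    conv_lhs => rw [hv]
    simp only [map_add, map_smul, smul_eq_mul, hver, hτ]
  rw [hI'a, fiberForm_apply]
  congr 2
  rw [_root_.sub_apply, _root_.smul_apply, hTv, hκ]
  simp [Fin.sum_univ_two]
  ring

end Gauge

/-! ### The determinant along the fibers -/

/-- Connections that are Hermitian-Yang-Mills for two different parameters force the determinant
line bundle to be trivial along the fibers. -/
theorem exists_det_fiber_eq {K : KahlerT2Structure} {E : UTwoBundle} {ε ε' : ℝ}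
    {Ξ Ξ' : UTwoConnection E} (hε : 0 < ε) (hε' : 0 < ε') (hne : ε ≠ ε')
    (h : IsHermitianYangMills K ε Ξ) (h' : IsHermitianYangMills K ε' Ξ') :
    ∃ φ : Cover → ℝ, ContDiff ℝ ∞ φ ∧
      (∀ n p, (E.e (0, n) p).det
        = Complex.exp (Complex.I * ((φ (p + fiberShift n) - φ p : ℝ) : ℂ))) ∧
      ∀ (Ξ : UTwoConnection E) b, fiberAverage (curl Ξ.traceForm) b (ver 0) (ver 1) = 0 := by
  set d : Fin 2 → Cover → ℂ := fun i p => (E.e (0, Pi.single i 1) p).det with hd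
  have hds : ∀ i, ContDiff ℝ ∞ (d i) := fun i => by
    have hent : ∀ k l, ContDiff ℝ ∞ fun p => E.e (0, Pi.single i 1) p k l := fun k l =>
      ((Matrix.entryLinearMap ℝ ℂ k l).toContinuousLinearMap : Mat →L[ℝ] ℂ).contDiff.comp
        (E.e_smooth _)
    simp only [hd, det_fin_two]
    exact ((hent 0 0).mul (hent 1 1)).sub ((hent 0 1).mul (hent 1 0))
  have hdn : ∀ i p, ‖d i p‖ = 1 := fun i p =>
    CStarRing.norm_of_mem_unitary (Matrix.det_of_mem_unitary (E.e_unitary _ p))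
  obtain ⟨φ, c, hφ, h₀, h₁⟩ := exists_automorphy_normalForm (hds 0) (hds 1) (hdn 0) (hdn 1)
    (.proj 0 ∘L .snd ℝ Plane Plane) (.proj 1 ∘L .snd ℝ Plane Plane) (ver 0) (ver 1)
    (by simp [ver]) (by simp [ver]) (by simp [ver]) fun p => by
      simp only [hd, ver_eq_shift, ← det_mul, ← E.e_add]
      rw [add_comm]
  have hc := fun (Ξ : UTwoConnection E) b => fiberAverage_curl_ver Ξ hφ h₀ h₁ b
  have hc0 := degree_eq_zero hε hε' hne h h' hc
  refine ⟨φ, hφ, E.det_fiber_eq fun i p => ?_, fun Ξ b => by rw [hc, hc0, neg_zero]⟩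
  fin_cases i
  · exact h₀ p
  · simpa [hc0] using h₁ p

end

theorem proposition7p1 (K : KahlerT2Structure) (hK : K.IsCalabiYau) (E : UTwoBundle)
    (ε : ℕ → ℝ) (hε : ∀ ν, 0 < ε ν ∧ ε ν ≤ 1) (hε₀ : Tendsto ε atTop (𝓝 0))
    (Ξ : ℕ → UTwoConnection E) (hΞ : ∀ ν, IsHermitianYangMills K (ε ν) (Ξ ν)) :
    ∃ (n : ℕ) (U : Fin n → Set (UnitAddTorus (Fin 2))),
      (∀ i, IsOpen (U i)) ∧ (⋃ i, U i) = Set.univ ∧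
      ∀ i, ∃ φ : ℕ → ℕ, StrictMono φ ∧
        ∃ s : ℕ → Cover → Mat, (∀ k, IsUnitaryFrame E (U i) (s k)) ∧
          ∃ α : Cover → Cover →L[ℝ] ℂ, ContDiffOn ℝ ∞ α (overBase (U i)) ∧
            ConvergesSmoothly (U i)
              (fun k => fiberwiseConstantPart
                (fun p => centralPart ((Ξ (φ k)).inFrame (s k) p))) α := by
  obtain ⟨μ, hμ⟩ := (hε₀.eventually_lt_const (hε 0).1).exists
  obtain ⟨φ, hφ, hdet, hdeg⟩ := exists_det_fiber_eq (hε 0).1 (hε μ).1 hμ.ne' (hΞ 0) (hΞ μ)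
  choose r hr hr2 s₀ hs₀ using fun b₀ => exists_isUnitaryFrame E hφ hdet b₀
  have hlift : ∀ x : UnitAddTorus (Fin 2), ∃ b : Plane, (fun i => (b i : UnitAddCircle)) = x :=
    fun x => by
      choose b hb using fun i => QuotientAddGroup.mk_surjective (x i)
      exact ⟨b, funext hb⟩
  choose ℓ hℓ using hlift
  obtain ⟨t, ht⟩ := CompactSpace.elim_nhds_subcover (fun x => baseChart (ℓ x) (r (ℓ x)))
    fun x => (isOpen_baseChart _ _).mem_nhds ⟨ℓ x, Metric.mem_ball_self (hr _), hℓ x⟩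
  refine ⟨t.card, fun i => baseChart (ℓ (t.equivFin.symm i)) (r (ℓ (t.equivFin.symm i))),
    fun i => isOpen_baseChart _ _, ?_, fun i => ?_⟩
  · refine Set.eq_univ_of_forall fun x => ?_
    have hx : x ∈ ⋃ y ∈ t, baseChart (ℓ y) (r (ℓ y)) := by rw [ht]; trivial
    obtain ⟨y, hy, hxy⟩ := Set.mem_iUnion₂.1 hx
    exact Set.mem_iUnion.2 ⟨t.equivFin ⟨y, hy⟩, by simpa using hxy⟩
  · set b₀ := ℓ (t.equivFin.symm i)
    choose s hs c hc hsc using fun ν => exists_frame_fiberwiseConstantPart_eq (Ξ ν) (Ξ 0) (hr2 b₀)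
      (hs₀ b₀) (fun j b => traceDiff_ver_eq (hε ν).1.ne' (hε 0).1.ne' (hΞ ν) (hΞ 0) j b 0)
      (fderiv_traceDiff_hor_symm (hΞ ν) (hΞ 0) hdeg)
    obtain ⟨c', -, ψ, hψ, hlim⟩ := isCompact_Icc.tendsto_subseq hc
    have hU := isOpen_baseChart b₀ (r b₀)
    have hα : ContDiffOn ℝ ∞ (fun p =>
        fiberwiseConstantPart (fun p => centralPart ((Ξ 0).inFrame (s₀ b₀) p)) p + fiberForm c')
        (overBase (baseChart b₀ (r b₀))) :=
      (contDiffOn_fiberwiseConstantPart hU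
        (contDiffOn_centralPart_inFrame hU (hs₀ b₀) (Ξ 0))).add contDiffOn_const
    refine ⟨ψ, hψ, fun k => s (ψ k), fun k => hs _, _, hα,
      convergesSmoothly_of_eq_add hU hα (D := fun k => fiberForm (c (ψ k) - c')) ?_ ?_⟩
    · have h := (continuous_fiberForm.tendsto c').comp hlim
      have h2 := h.sub_const (fiberForm c')
      rw [sub_self] at h2
      simpa only [Function.comp_apply, fiberForm_sub] using h2
    · intro k p hp
      rw [hsc _ p hp, ← fiberForm_sub, add_assoc, add_sub_cancel]
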